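/- Fix $d\in\mathbb N$ and a norm $|\cdot|$ on $\mathbb R^d$. Let $\mathrm K(\mathbb R^d)$ be the set of non-empty compact subsets of $\mathbb R^d$ with the Hausdorff metric $\mathrm{haus}$ induced by $|\cdot|$. For $f:[a,b]\to X$ with values in a metric space $(X,\rho)$ let $V_a^b(f)$ be its total variation, and let $v_f(x)=V_a^x(f)$ be its variation function. If $f$ has bounded variation, its left and right local quasi-moduli at $x\in(a,b)$ are, for $\delta>0$, $$\varpi^-(f,x,\delta)=\sup\{\rho(f(x-0),f(t)):t\in[x-\delta,x)\cap[a,b]\},\qquad \varpi^+(f,x,\delta)=\sup\{\rho(f(x+0),f(t)):t\in(x,x+\delta]\cap[a,b]\},$$ where $f(x\pm0)$ are the one-sided limits. Let $\mathcal F[a,b]$ be the class of all $F:[a,b]\to\mathrm K(\mathbb R^d)$ of bounded variation (with respect to $\mathrm{haus}$) with compact graph $\{(x,y):x\in[a,b],\ y\in F(x)\}$. A pair $(p,q)\in A\times B$ is a metric pair of $A,B\in\mathrm K(\mathbb R^d)$ if $|p-q|=\mathrm{dist}(q,A)$ or $|p-q|=\mathrm{dist}(p,B)$. A metric chain of $A_0,\dots,A_m$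 is a tuple $(y_0,\dots,y_m)$ with $y_i\in A_i$ such that $(y_i,y_{i+1})$ is a metric pair of $A_i,A_{i+1}$ for every $i<m$. For a partition $\chi$: $a=x_0<\dots<x_m=b$ put $|\chi|=\max_i(x_{i+1}-x_i)$. A chain function of $F$ based on $\chi$ is a function equal to $y_i$ on $[x_i,x_{i+1})$, $i<m$, and to $y_m$ at $x_m$, where $(y_0,\dots,y_m)$ is a metric chain of $F(x_0),\dots,F(x_m)$. A metric selection of $F$ is a function $s:[a,b]\to\mathbb R^d$ with $s(x)\in F(x)$ for all $x$ that is the pointwise limit on $[a,b]$ of chain functions of $F$ based on partitions $\chi_k$ with $|\chi_k|\to0$; $\mathcal S(F)$ is the set of metric selections of $F$. For $k:[a,b]\to\mathbb R$ the weighted metric integral of $F$ with weight $k$ is the set of all limits of convergent sequences $(z_j)$ such that $$z_j\in\Big\{\sum_{i=0}^{m-1}(x_{i+1}-x_i)k(x_i)y_i:\ (y_0,\dots,y_{m-1})\text{ a metric chain of }F(x_0),\dots,F(x_{m-1})\Big\}$$ for partitions $\chi_j=\{x_0,\dots,x_m\}$ ($m$ and the points depending on $j$) with $|\chi_j|\to0$.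 For $F\in\mathcal F[-\pi,\pi]$, $x\in(-\pi,\pi)$ and $n\ge1$ let $\mathscr S_nF(x)$ be $\frac1\pi$ times the weighted metric integral of $F$ over $[-\pi,\pi]$ with weight $t\mapsto D_n(x-t)$, where $D_n(u)=\frac12+\sum_{k=1}^n\cos(ku)$, and let $$A_F(x)=\Big\{\tfrac12\big(s(x+0)+s(x-0)\big):\ s\in\mathcal S(F)\Big\}.$$ **Proposition.** There is a constant $K>0$, depending only on the norm $|\cdot|$ on $\mathbb R^d$, such that the following holds. For every $x\in(-\pi,\pi)$ there is $\delta_0=\delta_0(x)>0$ such that for all $F\in\mathcal F[-\pi,\pi]$, all $\delta\in(0,\delta_0]$ and all integers $n\ge1$, the sets $\mathscr S_nF(x)$ and $A_F(x)$ are non-empty and $$\mathrm{haus}\big(\mathscr S_nF(x),A_F(x)\big)\le K\left[\frac{V_{-\pi}^{\pi}(F)}{n}\Big(1+6\cot\frac{\delta}{2}\Big)+\omega(\delta)\right],$$ where $\omega(\delta)=\max\{\varpi^-(v_F,x,2\delta),\ \varpi^+(v_F,x,\delta)\}$. -/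

import Mathlib

open Set Filter Topology TopologicalSpace

namespace MetricFourier

noncomputable section

/-! ### Regularity of functions on an interval with values in a metric space -/

/-- The variation function `x ↦ V_a^x(f)`. (The total variation is finite for the functions of
bounded variation to which this is applied.) -/
def variationFun {X : Type*} [PseudoMetricSpace X] (f : ℝ → X) (a x : ℝ) : ℝ :=
  (eVariationOn f (Icc a x)).toReal

/-- The left local quasi-modulus of `f : [a, b] → X` at `x` with step `δ`:
the supremum of `ρ(f(x-0), f(t))` over `t ∈ [x - δ, x) ∩ [a, b]`. -/
def leftQuasiModulus {X : Type*} [PseudoMetricSpace X] (a b : ℝ) (f : ℝ → X) (x δ : ℝ) : ℝ :=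
  sSup {r | ∃ t ∈ Ico (x - δ) x ∩ Icc a b, r = dist (Function.leftLim f x) (f t)}

/-- The right local quasi-modulus of `f : [a, b] → X` at `x` with step `δ`:
the supremum of `ρ(f(x+0), f(t))` over `t ∈ (x, x + δ] ∩ [a, b]`. -/
def rightQuasiModulus {X : Type*} [PseudoMetricSpace X] (a b : ℝ) (f : ℝ → X) (x δ : ℝ) : ℝ :=
  sSup {r | ∃ t ∈ Ioc x (x + δ) ∩ Icc a b, r = dist (Function.rightLim f x) (f t)}

/-- A partition `a = x_0 < x_1 < ⋯ < x_n = b` of `[a, b]`. -/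
structure IntervalPartition (a b : ℝ) where
  /-- the number of subintervals -/
  n : ℕ
  /-- the partition points -/
  pt : Fin (n + 1) → ℝ
  strictMono : StrictMono pt
  first : pt 0 = a
  last : pt (Fin.last n) = b

/-- The norm `|χ| = max_i (x_{i+1} - x_i)` of a partition. -/
def IntervalPartition.mesh {a b : ℝ} (χ : IntervalPartition a b) : ℝ :=
  ⨆ i : Fin χ.n, (χ.pt i.succ - χ.pt i.castSucc)

/-! ### Set-valued functions, metric chains, metric selections

A set-valued function on `[a, b]` is a map `F : ℝ → NonemptyCompacts E` of which only the values
on `[a, b]` are used. `NonemptyCompacts E` carries the Hausdorff metric. -/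

variable {E : Type*} [NormedAddCommGroup E] [NormedSpace ℝ E]

/-- The class of set-valued functions `F` on `[a, b]` with nonempty compact values that are of
bounded variation with respect to the Hausdorff metric and have a compact graph. -/
structure IsBVCompactGraph (a b : ℝ) (F : ℝ → NonemptyCompacts E) : Prop where
  boundedVariation : BoundedVariationOn F (Icc a b)
  isCompact_graph : IsCompact {p : ℝ × E | p.1 ∈ Icc a b ∧ p.2 ∈ F p.1}

/-- The set of projections (nearest points) of `a` on `B`. -/
def projections (a : E) (B : Set E) : Set E :=
  {b | b ∈ B ∧ dist a b = Metric.infDist a B}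

/-- The set of metric pairs of `A` and `B`. -/
def metricPairs (A B : Set E) : Set (E × E) :=
  {p | p.1 ∈ A ∧ p.2 ∈ B ∧ (p.1 ∈ projections p.2 A ∨ p.2 ∈ projections p.1 B)}

/-- `y` is a metric chain of the finite sequence of sets `A`: consecutive entries are metric pairs.
(For two or more sets the membership clause follows from the other one.) -/
def IsMetricChain {m : ℕ} (A : Fin m → NonemptyCompacts E) (y : Fin m → E) : Prop :=
  (∀ i, y i ∈ A i) ∧
    ∀ i j : Fin m, (i : ℕ) + 1 = j → (y i, y j) ∈ metricPairs (A i : Set E) (A j : Set E)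

/-- The function equal to `y_i` on `[x_i, x_{i+1})` for `i < n`, and to `y_n` at `x_n = b`
(and to `0` off `[a, b]`). It is a chain function of `F` when `y` is a metric chain of
`F(x_0), …, F(x_n)`. -/
def chainFun {a b : ℝ} (χ : IntervalPartition a b) (y : Fin (χ.n + 1) → E) (x : ℝ) : E :=
  (∑ i : Fin χ.n,
      (Ico (χ.pt i.castSucc) (χ.pt i.succ)).indicator (fun _ => y i.castSucc) x) +
    ({b} : Set ℝ).indicator (fun _ => y (Fin.last χ.n)) x

/-- `s` is a metric selection of `F` on `[a, b]`: a selection that is the pointwise limit on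
`[a, b]` of chain functions of `F` whose partitions have norms tending to zero. -/
def IsMetricSelection (a b : ℝ) (F : ℝ → NonemptyCompacts E) (s : ℝ → E) : Prop :=
  (∀ x ∈ Icc a b, s x ∈ F x) ∧
    ∃ (χ : ℕ → IntervalPartition a b) (y : ∀ k, Fin ((χ k).n + 1) → E),
      Tendsto (fun k => (χ k).mesh) atTop (𝓝 0) ∧
      (∀ k, IsMetricChain (fun i => F ((χ k).pt i)) (y k)) ∧
      ∀ x ∈ Icc a b, Tendsto (fun k => chainFun (χ k) (y k) x) atTop (𝓝 (s x))

/-! ### The weighted metric integral -/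

/-- The weighted metric Riemann sum of `F` with weight `k` on the partition `χ`: the set of all
`∑_{i<n} (x_{i+1} - x_i) k(x_i) y_i` with `(y_0, …, y_{n-1})` a metric chain of
`F(x_0), …, F(x_{n-1})`. -/
def weightedMetricRiemannSum {a b : ℝ} (k : ℝ → ℝ) (F : ℝ → NonemptyCompacts E)
    (χ : IntervalPartition a b) : Set E :=
  {z | ∃ y : Fin χ.n → E, IsMetricChain (fun i : Fin χ.n => F (χ.pt i.castSucc)) y ∧
    z = ∑ i : Fin χ.n, ((χ.pt i.succ - χ.pt i.castSucc) * k (χ.pt i.castSucc)) • y i}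

/-- The weighted metric integral of `F` over `[a, b]` with weight `k`: the Kuratowski upper limit
of the weighted metric Riemann sums as the norm of the partition tends to zero. -/
def weightedMetricIntegral (a b : ℝ) (k : ℝ → ℝ) (F : ℝ → NonemptyCompacts E) : Set E :=
  {z | ∃ (χ : ℕ → IntervalPartition a b) (w : ℕ → E),
    Tendsto (fun j => (χ j).mesh) atTop (𝓝 0) ∧
    (∀ j, w j ∈ weightedMetricRiemannSum k F (χ j)) ∧
    Tendsto w atTop (𝓝 z)}

/-! ### The metric Fourier approximants and the limit set -/

/-- The Dirichlet kernel `D_n(x) = 1/2 + ∑_{k=1}^n cos (k x)`. -/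
def dirichletKernel (n : ℕ) (x : ℝ) : ℝ :=
  1 / 2 + ∑ k ∈ Finset.Icc 1 n, Real.cos (k * x)

/-- The `n`-th partial sum `S_n F (x)` of the metric Fourier series of `F` on `[-π, π]`:
`1/π` times the weighted metric integral of `F` with the weight `t ↦ D_n(x - t)`. -/
def fourierSum (n : ℕ) (F : ℝ → NonemptyCompacts E) (x : ℝ) : Set E :=
  (fun z : E => (1 / Real.pi) • z) ''
    weightedMetricIntegral (-Real.pi) Real.pi (fun t => dirichletKernel n (x - t)) F

/-- The set `A_F(x)` of all `(s(x+0) + s(x-0)) / 2` with `s` a metric selection of `F`. -/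
def limitSet (F : ℝ → NonemptyCompacts E) (x : ℝ) : Set E :=
  {z | ∃ s : ℝ → E, IsMetricSelection (-Real.pi) Real.pi F s ∧
    z = (1 / 2 : ℝ) • (Function.rightLim s x + Function.leftLim s x)}

/-- `ω(δ)`: the maximum of the left quasi-modulus of `v_F` at `x` with step `2δ` and of the right
quasi-modulus of `v_F` at `x` with step `δ`, where `v_F` is the variation function of `F` on
`[-π, π]`. -/
def omega (F : ℝ → NonemptyCompacts E) (x δ : ℝ) : ℝ :=
  max (leftQuasiModulus (-Real.pi) Real.pi (variationFun F (-Real.pi)) x (2 * δ))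
    (rightQuasiModulus (-Real.pi) Real.pi (variationFun F (-Real.pi)) x δ)

end

end MetricFourier

/-! Both sets are parametrized by the metric selections of `F`, so it suffices to estimate the
Fourier series of one selection `s` at `x`, uniformly in `s`, and to pair the two points that come
from the same `s`.

The parametrization of the metric integral rests on compactness. A weighted metric Riemann sum is
the integral of a step function built on a metric chain. Chain functions obey a common variation
bound, so a Helly argument (`exists_subseq_tendsto_chainFun`) extracts a pointwise limit, which is a
metric selection because the graph is closed; dominated convergence (`tendsto_weightedSum_integral`)
passes to the limit in the sums. Hence the integral with continuous weight `k` is exactly the set of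
all `∫ k • s`.

Uniformity in `s` holds because consecutive entries of a metric chain are no further apart than the
corresponding values of `F`. In the limit, with `V` the extended variation function, `‖s v - s u‖ ≤
w v - w u` for the single monotone function `w t = V t + V (t - 0)` (`norm_limit_chainFun_sub_le`).

What remains is a quantitative Dirichlet–Jordan theorem for functions controlled by a monotone `w`
(`norm_fourier_sub_le`). The integral is cut at `x - δ`, `x`, `x + δ`, and on each piece Abel's
inequality trades the function for its variation and the kernel for its integrals. These are
`O(1/n)` away from the peaks and bounded by an absolute constant near them. Every estimate is made
directly in the norm of `E`, without coordinates, so even `K` is an absolute constant. -/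

namespace MetricFourier

/-! ### Abel's inequality for vector-valued functions of bounded variation. -/

section Abel

variable {E : Type*} [NormedAddCommGroup E] [NormedSpace ℝ E] [CompleteSpace E]

/-- Abel's inequality for the integral of the product of a continuous function and a function of
bounded variation, whose variation is controlled by `w`. -/
theorem norm_integral_smul_sub_le {f : ℝ → E} {φ w : ℝ → ℝ} {a b M : ℝ} (hab : a ≤ b)
    (hφ : Continuous φ) (hM : ∀ u ∈ Icc a b, |∫ t in u..b, φ t| ≤ M)
    (hf : IntervalIntegrable f MeasureTheory.volume a b)
    (hw : ∀ u ∈ Icc a b, ∀ v ∈ Icc a b, u ≤ v → ‖f v - f u‖ ≤ w v - w u) :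
    ‖(∫ t in a..b, φ t • f t) - (∫ t in a..b, φ t) • f a‖ ≤ M * (w b - w a) := by
  obtain ⟨C, hC⟩ := (isCompact_Icc (a := a) (b := b)).exists_bound_of_continuousOn hφ.continuousOn
  have hC0 : 0 ≤ C := (norm_nonneg _).trans (hC a ⟨le_rfl, hab⟩)
  have hfI : ∀ u ∈ Icc a b, ∀ v ∈ Icc a b, IntervalIntegrable f MeasureTheory.volume u v :=
    fun u hu v hv => hf.mono_set (by rw [uIcc_of_le hab]; exact uIcc_subset_Icc hu hv)
  have hI : ∀ c : E, ∀ u ∈ Icc a b, ∀ v ∈ Icc a b,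
      IntervalIntegrable (fun t => φ t • (f t - c)) MeasureTheory.volume u v :=
    fun c u hu v hv => ((hfI u hu v hv).sub intervalIntegrable_const).continuousOn_smul
      hφ.continuousOn
  -- `J` replaces integration by parts. `J a` is the quantity to bound, `J b = 0`, and moving the
  -- base point from `u` to `v` costs `M * (w v - w u)` plus an error carrying the extra factor `v -
  -- u`.
  set J : ℝ → E := fun u => ∫ t in u..b, φ t • (f t - f u) with hJ
  have hb : b ∈ Icc a b := ⟨hab, le_rfl⟩
  have ha : a ∈ Icc a b := ⟨le_rfl, hab⟩
  have hstep : ∀ u ∈ Icc a b, ∀ v ∈ Icc a b, u ≤ v →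
      dist (J u) (J v) ≤ (C * (v - u) + M) * (w v - w u) := by
    intro u hu v hv huv
    have h1 : J u - J v = (∫ t in u..v, φ t • (f t - f u)) + (∫ t in v..b, φ t) • (f v - f u) := by
      simp only [hJ]
      rw [← intervalIntegral.integral_add_adjacent_intervals (hI (f u) u hu v hv)
        (hI (f u) v hv b hb), add_sub_assoc, ← intervalIntegral.integral_sub (hI _ v hv b hb)
        (hI _ v hv b hb), ← intervalIntegral.integral_smul_const]
      congr 2
      ext t
      rw [← smul_sub]
      congr 1
      abel
    rw [dist_eq_norm, h1]
    have hw0 := (norm_nonneg _).trans (hw u hu v hv huv)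
    have h2 : ‖∫ t in u..v, φ t • (f t - f u)‖ ≤ C * (w v - w u) * |v - u| := by
      apply intervalIntegral.norm_integral_le_of_norm_le_const
      intro t ht
      rw [uIoc_of_le huv] at ht
      have htI : t ∈ Icc a b := ⟨hu.1.trans ht.1.le, ht.2.trans hv.2⟩
      rw [norm_smul]
      refine mul_le_mul (hC t htI) ?_ (norm_nonneg _) hC0
      have h3 := hw u hu t htI ht.1.le
      have h4 := (norm_nonneg _).trans (hw t htI v hv ht.2)
      linarith
    have h3 : ‖(∫ t in v..b, φ t) • (f v - f u)‖ ≤ M * (w v - w u) := by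
      rw [norm_smul]
      exact mul_le_mul (hM v hv) (hw u hu v hv huv) (norm_nonneg _)
        ((abs_nonneg _).trans (hM v hv))
    rw [abs_of_nonneg (sub_nonneg.2 huv)] at h2
    calc _ ≤ _ := norm_add_le _ _
      _ ≤ _ := add_le_add h2 h3
      _ = _ := by ring
  have hJa : J a = (∫ t in a..b, φ t • f t) - (∫ t in a..b, φ t) • f a := by
    simp only [hJ]
    rw [← intervalIntegral.integral_smul_const, ← intervalIntegral.integral_sub
      (hf.continuousOn_smul hφ.continuousOn) (intervalIntegrable_const.continuousOn_smul hφ.continuousOn)]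
    simp only [smul_sub]
  have hJb : J b = 0 := by simp [hJ]
  rw [← hJa]
  -- Summing over `N + 1` equal steps telescopes `w`; the error term is `C` times the step length
  -- and disappears as `N` grows.
  have hN : ∀ N : ℕ, ‖J a‖ ≤ (C * ((b - a) * (1 / ((N : ℝ) + 1))) + M) * (w b - w a) := by
    intro N
    have hN0 : (0 : ℝ) < (N : ℝ) + 1 := by positivity
    set h := (b - a) * (1 / ((N : ℝ) + 1)) with hh
    have hh0 : 0 ≤ h := mul_nonneg (sub_nonneg.2 hab) (by positivity)
    have hend : a + ((N + 1 : ℕ) : ℝ) * h = b := by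
      rw [hh]; push_cast; field_simp; ring
    have hmem : ∀ k : ℕ, k ≤ N + 1 → a + (k : ℝ) * h ∈ Icc a b := by
      intro k hk
      refine ⟨le_add_of_nonneg_right (by positivity), ?_⟩
      rw [← hend]
      gcongr
    have := dist_le_range_sum_of_dist_le (f := fun k : ℕ => J (a + (k : ℝ) * h))
      (d := fun k : ℕ => (C * h + M) * (w (a + ((k + 1 : ℕ) : ℝ) * h) - w (a + (k : ℝ) * h))) (N + 1)
      (fun {k} hk => by
        have h1 := hstep _ (hmem k hk.le) _ (hmem (k + 1) hk) (by push_cast; nlinarith)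
        refine h1.trans (le_of_eq ?_)
        congr 3
        push_cast; ring)
    rw [← Finset.mul_sum, Finset.sum_range_sub (fun k : ℕ => w (a + (k : ℝ) * h)), hend] at this
    simpa [hJb] using this
  have hlim : Tendsto (fun N : ℕ => (C * ((b - a) * (1 / ((N : ℝ) + 1))) + M) * (w b - w a)) atTop
      (𝓝 ((C * ((b - a) * 0) + M) * (w b - w a))) :=
    (((tendsto_one_div_add_atTop_nhds_zero_nat.const_mul _).const_mul _).add_const _).mul_const _
  simpa using ge_of_tendsto' hlim hN

/-- The integral of `φ • (f - c)` when all the integrals of `φ` over subintervals are small. -/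
theorem norm_integral_smul_sub_const_le {f : ℝ → E} {φ w : ℝ → ℝ} {a b M : ℝ} (hab : a ≤ b)
    (hφ : Continuous φ) (hM : ∀ u ∈ Icc a b, |∫ t in u..b, φ t| ≤ M)
    (hf : IntervalIntegrable f MeasureTheory.volume a b)
    (hw : ∀ u ∈ Icc a b, ∀ v ∈ Icc a b, u ≤ v → ‖f v - f u‖ ≤ w v - w u) (c : E) :
    ‖∫ t in a..b, φ t • (f t - c)‖ ≤ M * (w b - w a + ‖f a - c‖) := by
  have h := norm_integral_smul_sub_le hab hφ hM (hf.sub (intervalIntegrable_const (c := c)))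
    (w := w) (fun u hu v hv huv => by simpa using hw u hu v hv huv)
  have h2 : ‖(∫ t in a..b, φ t) • (f a - c)‖ ≤ M * ‖f a - c‖ := by
    rw [norm_smul]
    exact mul_le_mul_of_nonneg_right (hM a ⟨le_rfl, hab⟩) (norm_nonneg _)
  calc _ = ‖((∫ t in a..b, φ t • (f t - c)) - (∫ t in a..b, φ t) • (f a - c)) +
        (∫ t in a..b, φ t) • (f a - c)‖ := by rw [sub_add_cancel]
    _ ≤ _ := norm_add_le _ _
    _ ≤ _ := add_le_add h h2
    _ = _ := by ring

end Abel

/-! ### Integrals of the Dirichlet kernel. -/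

section Kernel

theorem continuous_dirichletKernel (n : ℕ) : Continuous (dirichletKernel n) := by
  unfold dirichletKernel
  fun_prop

theorem dirichletKernel_neg (n : ℕ) (x : ℝ) : dirichletKernel n (-x) = dirichletKernel n x := by
  simp [dirichletKernel]

theorem dirichletKernel_add_two_pi (n : ℕ) (x : ℝ) :
    dirichletKernel n (x + 2 * Real.pi) = dirichletKernel n x := by
  unfold dirichletKernel
  congr 1
  refine Finset.sum_congr rfl fun k _ => ?_
  rw [mul_add, Real.cos_add_nat_mul_two_pi]

theorem abs_dirichletKernel_le (n : ℕ) (x : ℝ) : |dirichletKernel n x| ≤ n + 1 / 2 := by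
  unfold dirichletKernel
  calc _ ≤ |(1 / 2 : ℝ)| + |∑ k ∈ Finset.Icc 1 n, Real.cos (k * x)| := abs_add_le _ _
    _ ≤ 1 / 2 + ∑ k ∈ Finset.Icc 1 n, (1 : ℝ) := by
      gcongr
      · norm_num
      · exact (Finset.abs_sum_le_sum_abs _ _).trans
          (Finset.sum_le_sum fun k _ => Real.abs_cos_le_one _)
    _ = _ := by simp; ring

theorem two_mul_sin_mul_dirichletKernel (n : ℕ) (x : ℝ) :
    2 * Real.sin (x / 2) * dirichletKernel n x = Real.sin ((n + 1 / 2) * x) := by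
  induction n with
  | zero => simp [dirichletKernel]; ring_nf
  | succ n ih =>
    have h : dirichletKernel (n + 1) x = dirichletKernel n x + Real.cos ((n + 1 : ℕ) * x) := by
      unfold dirichletKernel
      rw [Finset.sum_Icc_succ_top (by omega), add_assoc]
    rw [h, mul_add, ih]
    have h1 : ((n : ℝ) + 1 / 2) * x = (n + 1) * x - x / 2 := by ring
    have h2 : (((n + 1 : ℕ) : ℝ) + 1 / 2) * x = (n + 1) * x + x / 2 := by push_cast; ring
    rw [h1, h2, Real.sin_sub, Real.sin_add]
    push_cast
    ring

theorem integral_dirichletKernel_zero_pi (n : ℕ) :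
    ∫ t in (0 : ℝ)..Real.pi, dirichletKernel n t = Real.pi / 2 := by
  unfold dirichletKernel
  rw [intervalIntegral.integral_add (by simp) ((by fun_prop : Continuous _).intervalIntegrable _ _),
    intervalIntegral.integral_finsetSum
      fun k _ => (by fun_prop : Continuous _).intervalIntegrable _ _,
    Finset.sum_eq_zero]
  · simp; ring
  · intro k hk
    have hk0 : (k : ℝ) ≠ 0 := by
      have := (Finset.mem_Icc.1 hk).1
      positivity
    rw [intervalIntegral.integral_comp_mul_left (fun t => Real.cos t) hk0]
    simp

theorem integral_dirichletKernel_neg (n : ℕ) (u v : ℝ) :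
    ∫ t in -u..-v, dirichletKernel n t = ∫ t in v..u, dirichletKernel n t := by
  rw [← intervalIntegral.integral_comp_neg]
  simp [dirichletKernel_neg]

theorem abs_integral_sin_mul_le {c : ℝ} (hc : 0 < c) (u v : ℝ) :
    |∫ t in u..v, Real.sin (c * t)| ≤ 2 / c := by
  rw [intervalIntegral.integral_comp_mul_left (fun t => Real.sin t) hc.ne', integral_sin,
    smul_eq_mul, abs_mul, abs_of_pos (inv_pos.2 hc), div_eq_inv_mul]
  gcongr
  have h1 := Real.abs_cos_le_one (c * u)
  have h2 := Real.abs_cos_le_one (c * v)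
  have := abs_sub (Real.cos (c * u)) (Real.cos (c * v))
  linarith

/-- Infinitesimally this is `|cos| / sin² ≤ 1 / sin²`. The function `1 / sin` is not monotone on
`(0, π)`, but the monotone function `-cot` dominates its variation and can serve as `w` in Abel's
inequality. -/
theorem abs_inv_sin_sub_le {p q : ℝ} (hp : 0 < p) (hpq : p ≤ q) (hq : q < Real.pi) :
    |(Real.sin q)⁻¹ - (Real.sin p)⁻¹| ≤ Real.cot p - Real.cot q := by
  have sp : 0 < Real.sin p := Real.sin_pos_of_pos_of_lt_pi hp (by linarith)
  have sq : 0 < Real.sin q := Real.sin_pos_of_pos_of_lt_pi (by linarith) hq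
  have sd : 0 ≤ Real.sin (q - p) := Real.sin_nonneg_of_nonneg_of_le_pi (by linarith) (by linarith)
  have h1 : Real.sin q = Real.sin p * Real.cos (q - p) + Real.cos p * Real.sin (q - p) := by
    rw [← Real.sin_add]; congr 1; ring
  have h2 : Real.sin p = Real.sin q * Real.cos (q - p) - Real.cos q * Real.sin (q - p) := by
    rw [← Real.sin_sub]; congr 1; ring
  have key : |Real.sin p - Real.sin q| ≤ Real.sin (q - p) := by
    have c1 := Real.cos_le_one (q - p)
    have c2 := Real.cos_le_one p
    have c3 := Real.neg_one_le_cos q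
    rw [abs_le]
    constructor <;> nlinarith
  have e1 : (Real.sin q)⁻¹ - (Real.sin p)⁻¹ =
      (Real.sin p - Real.sin q) / (Real.sin p * Real.sin q) := by
    field_simp
  have e2 : Real.cot p - Real.cot q = Real.sin (q - p) / (Real.sin p * Real.sin q) := by
    rw [Real.cot_eq_cos_div_sin, Real.cot_eq_cos_div_sin, Real.sin_sub]
    field_simp
  rw [e1, e2, abs_div, abs_of_pos (mul_pos sp sq)]
  gcongr

theorem inv_sin_le_one_add_cot {p : ℝ} (hp : 0 < p) (hq : p ≤ Real.pi / 2) :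
    (Real.sin p)⁻¹ ≤ 1 + Real.cot p := by
  have sp : 0 < Real.sin p := Real.sin_pos_of_pos_of_lt_pi hp (by linarith)
  have cp : 0 ≤ Real.cos p := Real.cos_nonneg_of_neg_pi_div_two_le_of_le (by linarith) hq
  rw [Real.cot_eq_cos_div_sin, inv_eq_one_div, div_le_iff₀ sp, add_mul, div_mul_cancel₀ _ sp.ne']
  nlinarith [Real.sin_sq_add_cos_sq p, Real.sin_le_one p, Real.cos_le_one p]

theorem cot_nonneg {p : ℝ} (hp : 0 < p) (hq : p ≤ Real.pi / 2) : 0 ≤ Real.cot p := by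
  have sp : 0 < Real.sin p := Real.sin_pos_of_pos_of_lt_pi hp (by linarith)
  have cp : 0 ≤ Real.cos p := Real.cos_nonneg_of_neg_pi_div_two_le_of_le (by linarith) hq
  rw [Real.cot_eq_cos_div_sin]
  positivity

/-- Integrals of the Dirichlet kernel away from its peaks are `O(1/n)`. -/
theorem abs_integral_dirichletKernel_le_cot {n : ℕ} (hn : 1 ≤ n) {δ u v : ℝ} (hδ : 0 < δ)
    (hδπ : δ ≤ Real.pi) (hu : δ ≤ u) (huv : u ≤ v) (hv : v ≤ 2 * Real.pi - δ) :
    |∫ t in u..v, dirichletKernel n t| ≤ 1 / n * (1 + 6 * Real.cot (δ / 2)) := by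
  have hn0 : (0 : ℝ) < n := by exact_mod_cast hn
  have hs : ∀ t ∈ Icc u v, 0 < Real.sin (t / 2) := fun t ht =>
    Real.sin_pos_of_pos_of_lt_pi (by linarith [ht.1]) (by linarith [ht.2])
  set c : ℝ := n + 1 / 2 with hc
  have hc0 : 0 < c := by positivity
  set g : ℝ → ℝ := fun t => (1 / 2) * (Real.sin (t / 2))⁻¹ with hg
  have hgc : ContinuousOn g (Icc u v) := by
    refine continuousOn_const.mul (ContinuousOn.inv₀ (by fun_prop) fun t ht => (hs t ht).ne')
  -- Here `D_n(t) = sin(ct) / (2 sin(t/2))`: the oscillating factor has integrals at most `2 / c`,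
  -- and the other factor is controlled by `-cot(t/2) / 2`.
  have h := norm_integral_smul_sub_le (f := g) (φ := fun t => Real.sin (c * t))
    (w := fun t => -((1 / 2) * Real.cot (t / 2))) (M := 2 / c) huv (by fun_prop)
    (fun t _ => abs_integral_sin_mul_le hc0 _ _)
    (by rw [← uIcc_of_le huv] at hgc; exact hgc.intervalIntegrable)
    (fun p hp q hq hpq => by
      have := abs_inv_sin_sub_le (p := p / 2) (q := q / 2) (by linarith [hp.1]) (by linarith)
        (by linarith [hq.2])
      simp only [hg, ← mul_sub]
      rw [Real.norm_eq_abs, abs_mul, abs_of_pos (by norm_num : (0 : ℝ) < 1 / 2)]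
      linarith)
  have e : ∫ t in u..v, Real.sin (c * t) • g t = ∫ t in u..v, dirichletKernel n t := by
    refine intervalIntegral.integral_congr fun t ht => ?_
    rw [uIcc_of_le huv] at ht
    have := (hs t ht).ne'
    simp only [hg, hc, ← two_mul_sin_mul_dirichletKernel, smul_eq_mul]
    field_simp
  rw [e] at h
  have h0 := inv_sin_le_one_add_cot (p := δ / 2) (by linarith) (by linarith)
  have hcot0 := cot_nonneg (p := δ / 2) (by linarith) (by linarith)
  have hsd : 0 < Real.sin (δ / 2) := Real.sin_pos_of_pos_of_lt_pi (by linarith) (by linarith)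
  have h1 := abs_inv_sin_sub_le (p := δ / 2) (q := u / 2) (by linarith) (by linarith) (by linarith)
  have h2 := abs_inv_sin_sub_le (p := v / 2) (q := Real.pi - δ / 2) (by linarith) (by linarith)
    (by linarith)
  have h3 : Real.cot (Real.pi - δ / 2) = - Real.cot (δ / 2) := by
    rw [Real.cot_eq_cos_div_sin, Real.cot_eq_cos_div_sin, Real.cos_pi_sub, Real.sin_pi_sub, neg_div]
  have h5 := abs_inv_sin_sub_le (p := u / 2) (q := Real.pi - δ / 2) (by linarith) (by linarith)
    (by linarith)
  -- Comparison of `1 / sin(u/2)` with `1 / sin(δ/2) ≤ 1 + cot(δ/2)` adds `cot(δ/2) - cot(u/2)`, and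
  -- `-cot(u/2) ≤ cot(δ/2)` because `u/2 ≤ π - δ/2`.
  have hgu : |g u| ≤ 1 / 2 * (1 + 3 * Real.cot (δ / 2)) := by
    have := (abs_le.1 h1).2
    have hsu := inv_pos.2 (hs u ⟨le_rfl, huv⟩)
    rw [hg, abs_of_nonneg (by positivity)]
    have := (abs_nonneg _).trans h5
    linarith
  have h4 : |(∫ t in u..v, Real.sin (c * t)) • g u| ≤
      2 / c * (1 / 2 * (1 + 3 * Real.cot (δ / 2))) := by
    rw [smul_eq_mul, abs_mul]
    exact mul_le_mul (abs_integral_sin_mul_le hc0 _ _) hgu (abs_nonneg _) (by positivity)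
  have h6 : -(1 / 2 * Real.cot (v / 2)) - -(1 / 2 * Real.cot (u / 2)) ≤ Real.cot (δ / 2) := by
    have a1 := (abs_nonneg _).trans h1
    have a2 := (abs_nonneg _).trans h2
    linarith
  have h7 : |∫ t in u..v, dirichletKernel n t| ≤
      2 / c * Real.cot (δ / 2) + 2 / c * (1 / 2 * (1 + 3 * Real.cot (δ / 2))) := by
    calc _ = |((∫ t in u..v, dirichletKernel n t) - (∫ t in u..v, Real.sin (c * t)) • g u) +
          (∫ t in u..v, Real.sin (c * t)) • g u| := by rw [sub_add_cancel]
      _ ≤ _ := abs_add_le _ _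
      _ ≤ _ := add_le_add (h.trans (mul_le_mul_of_nonneg_left h6 (by positivity))) h4
  calc _ ≤ _ := h7
    _ = 1 / c * (1 + 5 * Real.cot (δ / 2)) := by ring
    _ ≤ _ := by
      gcongr
      · simp [hc]
      · norm_num

/-- Integrals of the Dirichlet kernel are uniformly bounded. -/
theorem abs_integral_dirichletKernel_le {n : ℕ} (hn : 1 ≤ n) {u v : ℝ} (hu : 0 ≤ u)
    (huv : u ≤ v) (hv : v ≤ Real.pi) : |∫ t in u..v, dirichletKernel n t| ≤ 30 := by
  have hn0 : (1 : ℝ) ≤ n := by exact_mod_cast hn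
  have hn1 : 1 / (n : ℝ) ≤ 1 := by rw [div_le_one (by linarith)]; exact hn0
  have hinv : 0 < 1 / (n : ℝ) := by positivity
  have hpi := Real.pi_gt_three
  -- The interval is cut at `1 / n`. Below it the trivial bound `n + 1/2` on the kernel suffices;
  -- above it the cotangent bound with `δ = 1 / n` does, since `cot(1/(2n)) = O(n)`. The sum of the
  -- two bounds is `2 + 28 = 30`.
  have near : ∀ u v : ℝ, 0 ≤ u → u ≤ v → v ≤ 1 / n → |∫ t in u..v, dirichletKernel n t| ≤ 2 := by
    intro u v hu huv hv
    have := intervalIntegral.norm_integral_le_of_norm_le_const (a := u) (b := v)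
      (f := dirichletKernel n) (C := n + 1 / 2) (fun t _ => abs_dirichletKernel_le n t)
    rw [Real.norm_eq_abs, abs_of_nonneg (sub_nonneg.2 huv)] at this
    refine this.trans ?_
    calc (n + 1 / 2 : ℝ) * (v - u) ≤ (n + 1 / 2 : ℝ) * (1 / n) := by gcongr; linarith
      _ = 1 + 1 / 2 * (1 / n) := by field_simp
      _ ≤ 2 := by linarith
  have far : ∀ u v : ℝ, 1 / n ≤ u → u ≤ v → v ≤ Real.pi →
      |∫ t in u..v, dirichletKernel n t| ≤ 28 := by
    intro u v hu huv hv
    refine (abs_integral_dirichletKernel_le_cot hn hinv (by linarith) hu huv (by linarith)).trans ?_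
    have hcot : Real.cot (1 / n / 2) ≤ 4 * n := by
      have hs := Real.mul_le_sin (x := 1 / n / 2) (by positivity) (by linarith)
      have hpi4 := Real.pi_le_four
      have hs2 : 1 / (4 * n) ≤ Real.sin (1 / n / 2) := by
        refine le_trans ?_ hs
        rw [div_div, div_mul_div_comm, div_le_div_iff₀ (by positivity) (by positivity)]
        nlinarith
      have hs0 : 0 < Real.sin (1 / n / 2) := lt_of_lt_of_le (by positivity) hs2
      rw [Real.cot_eq_cos_div_sin, div_le_iff₀ hs0]
      rw [div_le_iff₀ (by positivity)] at hs2
      linarith [Real.cos_le_one (1 / n / 2)]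
    calc 1 / n * (1 + 6 * Real.cot (1 / n / 2)) ≤ 1 / n * (1 + 6 * (4 * n)) := by gcongr
      _ = 1 / n + 24 := by field_simp; ring
      _ ≤ 28 := by linarith
  rcases le_total v (1 / n : ℝ) with h | h
  · linarith [near u v hu huv h]
  rcases le_total (1 / n : ℝ) u with h' | h'
  · linarith [far u v h' huv hv]
  rw [← intervalIntegral.integral_add_adjacent_intervals
    ((continuous_dirichletKernel n).intervalIntegrable u (1 / n))
    ((continuous_dirichletKernel n).intervalIntegrable (1 / n) v)]
  refine (abs_add_le _ _).trans ?_
  linarith [near u _ hu h' le_rfl, far _ v le_rfl h hv]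

end Kernel

end MetricFourier

namespace MetricFourier

/-! ### The variation function and its local quasi-moduli. -/

section Variation

variable {X : Type*} [PseudoMetricSpace X]

/-- The variation function of `f` on `[a, b]`, extended to a function constant on each of the two
components of the complement of `[a, b]`. -/
noncomputable def extVariation (f : ℝ → X) (a b t : ℝ) : ℝ := variationFun f a (max a (min b t))

theorem extVariation_of_mem (f : ℝ → X) {a b t : ℝ} (ht : t ∈ Icc a b) :
    extVariation f a b t = variationFun f a t := by
  rw [extVariation, min_eq_right ht.2, max_eq_right ht.1]

theorem dist_le_variationFun_sub {f : ℝ → X} {a b u v : ℝ} (hf : BoundedVariationOn f (Icc a b))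
    (hu : a ≤ u) (huv : u ≤ v) (hv : v ≤ b) :
    dist (f u) (f v) ≤ variationFun f a v - variationFun f a u := by
  have hfin : ∀ p q : ℝ, a ≤ p → q ≤ b → eVariationOn f (Icc p q) ≠ ⊤ := fun p q hp hq =>
    hf.mono (Icc_subset_Icc hp hq)
  have h := eVariationOn.Icc_add_Icc f (s := univ) hu huv (mem_univ u)
  simp only [univ_inter] at h
  have h2 := eVariationOn.edist_le f (s := Icc u v) (x := u) (y := v) ⟨le_rfl, huv⟩ ⟨huv, le_rfl⟩
  unfold variationFun
  rw [← h, ENNReal.toReal_add (hfin a u le_rfl (huv.trans hv)) (hfin u v hu hv),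
    add_sub_cancel_left, dist_edist]
  exact ENNReal.toReal_mono (hfin u v hu hv) h2

/-- Monotonicity on the whole line is the point of the extension: one-sided limits exist everywhere,
and arguments such as `u - χ.mesh` may leave `[a, b]`. -/
theorem monotone_extVariation {f : ℝ → X} {a b : ℝ} (hab : a ≤ b)
    (hf : BoundedVariationOn f (Icc a b)) : Monotone (extVariation f a b) := by
  intro u v huv
  have h := dist_le_variationFun_sub hf (le_max_left a (min b u))
    (max_le_max le_rfl (min_le_min le_rfl huv) : _ ≤ max a (min b v)) (max_le hab (min_le_left _ _))
  exact sub_nonneg.1 (dist_nonneg.trans h)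

theorem extVariation_nonneg (f : ℝ → X) (a b t : ℝ) : 0 ≤ extVariation f a b t :=
  ENNReal.toReal_nonneg

theorem extVariation_le {f : ℝ → X} {a b : ℝ} (hab : a ≤ b)
    (hf : BoundedVariationOn f (Icc a b)) (t : ℝ) : extVariation f a b t ≤ variationFun f a b := by
  have h : extVariation f a b t = extVariation f a b (min b t) := by simp [extVariation]
  rw [h, ← extVariation_of_mem f (right_mem_Icc.2 hab)]
  exact monotone_extVariation hab hf (min_le_left _ _)

theorem rightLim_variationFun {f : ℝ → X} {a b x : ℝ} (hx : x ∈ Ioo a b)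
    (hf : BoundedVariationOn f (Icc a b)) :
    Function.rightLim (variationFun f a) x = Function.rightLim (extVariation f a b) x := by
  refine rightLim_eq_of_tendsto ?_
  refine ((monotone_extVariation (hx.1.trans hx.2).le hf).tendsto_rightLim x).congr' ?_
  filter_upwards [mem_nhdsWithin_of_mem_nhds (Ioo_mem_nhds hx.1 hx.2)] with t ht
  exact extVariation_of_mem f (Ioo_subset_Icc_self ht)

theorem leftLim_variationFun {f : ℝ → X} {a b x : ℝ} (hx : x ∈ Ioo a b)
    (hf : BoundedVariationOn f (Icc a b)) :
    Function.leftLim (variationFun f a) x = Function.leftLim (extVariation f a b) x := by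
  refine leftLim_eq_of_tendsto ?_
  refine ((monotone_extVariation (hx.1.trans hx.2).le hf).tendsto_leftLim x).congr' ?_
  filter_upwards [mem_nhdsWithin_of_mem_nhds (Ioo_mem_nhds hx.1 hx.2)] with t ht
  exact extVariation_of_mem f (Ioo_subset_Icc_self ht)

/-- The endpoint `x + δ` is itself admissible in the supremum, provided that it lies in `[a, b]`.
Boundedness has to be checked because a real `sSup` of an unbounded set is `0`. -/
theorem sub_rightLim_le_rightQuasiModulus {f : ℝ → X} {a b x δ : ℝ} (hx : x ∈ Ioo a b) (hδ : 0 < δ)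
    (hδb : x + δ ≤ b) (hf : BoundedVariationOn f (Icc a b)) :
    extVariation f a b (x + δ) - Function.rightLim (extVariation f a b) x ≤
      rightQuasiModulus a b (variationFun f a) x δ := by
  have hab := (hx.1.trans hx.2).le
  have hmem : x + δ ∈ Icc a b := ⟨by linarith [hx.1], hδb⟩
  have hV : ∀ t ∈ Icc a b, dist (Function.rightLim (extVariation f a b) x) (variationFun f a t) ≤
      |Function.rightLim (extVariation f a b) x| + variationFun f a b := fun t ht => by
    rw [← extVariation_of_mem f ht, Real.dist_eq]
    refine (abs_sub _ _).trans ?_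
    rw [abs_of_nonneg (extVariation_nonneg f a b t)]
    gcongr
    exact extVariation_le hab hf t
  refine le_trans ?_ (le_csSup (a := dist (Function.rightLim (variationFun f a) x)
    (variationFun f a (x + δ))) ⟨|Function.rightLim (extVariation f a b) x| + variationFun f a b, ?_⟩
    ⟨x + δ, ⟨⟨by linarith, le_rfl⟩, hmem⟩, rfl⟩)
  · rw [rightLim_variationFun hx hf, ← extVariation_of_mem f hmem, dist_comm, Real.dist_eq]
    exact le_abs_self _
  · rintro r ⟨t, ht, rfl⟩
    rw [rightLim_variationFun hx hf]
    exact hV t ht.2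

theorem leftLim_sub_le_leftQuasiModulus {f : ℝ → X} {a b x δ : ℝ} (hx : x ∈ Ioo a b) (hδ : 0 < δ)
    (hδb : a ≤ x - δ) (hf : BoundedVariationOn f (Icc a b)) :
    Function.leftLim (extVariation f a b) x - extVariation f a b (x - δ) ≤
      leftQuasiModulus a b (variationFun f a) x δ := by
  have hab := (hx.1.trans hx.2).le
  have hmem : x - δ ∈ Icc a b := ⟨hδb, by linarith [hx.2]⟩
  have hV : ∀ t ∈ Icc a b, dist (Function.leftLim (extVariation f a b) x) (variationFun f a t) ≤
      |Function.leftLim (extVariation f a b) x| + variationFun f a b := fun t ht => by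
    rw [← extVariation_of_mem f ht, Real.dist_eq]
    refine (abs_sub _ _).trans ?_
    rw [abs_of_nonneg (extVariation_nonneg f a b t)]
    gcongr
    exact extVariation_le hab hf t
  refine le_trans ?_ (le_csSup (a := dist (Function.leftLim (variationFun f a) x)
    (variationFun f a (x - δ))) ⟨|Function.leftLim (extVariation f a b) x| + variationFun f a b, ?_⟩
    ⟨x - δ, ⟨⟨le_rfl, by linarith⟩, hmem⟩, rfl⟩)
  · rw [leftLim_variationFun hx hf, ← extVariation_of_mem f hmem, Real.dist_eq]
    exact le_abs_self _
  · rintro r ⟨t, ht, rfl⟩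
    rw [leftLim_variationFun hx hf]
    exact hV t ht.2

end Variation

/-! ### Partitions, chain functions and their integrals. -/

section Partition

variable {a b : ℝ}

namespace IntervalPartition

theorem pt_mem (χ : IntervalPartition a b) (i : Fin (χ.n + 1)) : χ.pt i ∈ Icc a b :=
  ⟨χ.first.ge.trans (χ.strictMono.monotone (Fin.zero_le i)),
    (χ.strictMono.monotone (Fin.le_last i)).trans_eq χ.last⟩

theorem sub_le_mesh (χ : IntervalPartition a b) (i : Fin χ.n) :
    χ.pt i.succ - χ.pt i.castSucc ≤ χ.mesh :=
  le_ciSup (f := fun i : Fin χ.n => χ.pt i.succ - χ.pt i.castSucc) (finite_range _).bddAbove i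

theorem mesh_nonneg (χ : IntervalPartition a b) : 0 ≤ χ.mesh :=
  Real.iSup_nonneg fun i => sub_nonneg.2 (χ.strictMono.monotone i.castSucc_lt_succ.le)

/-- The partition of `[a, b]` into `N + 1` equal parts. -/
noncomputable def uniform (hab : a < b) (N : ℕ) : IntervalPartition a b where
  n := N + 1
  pt i := a + (i : ℕ) * ((b - a) * (1 / ((N : ℝ) + 1)))
  strictMono i j hij := by
    have h1 : ((i : ℕ) : ℝ) < (j : ℕ) := by exact_mod_cast hij
    have h2 : 0 < (b - a) * (1 / ((N : ℝ) + 1)) := mul_pos (sub_pos.2 hab) (by positivity)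
    dsimp only
    gcongr
  first := by simp
  last := by
    have hN0 : (N : ℝ) + 1 ≠ 0 := by positivity
    simp only [Fin.val_last]
    push_cast
    field_simp
    ring

theorem tendsto_mesh_uniform (hab : a < b) :
    Tendsto (fun N => (uniform hab N).mesh) atTop (𝓝 0) := by
  have h : Tendsto (fun N : ℕ => (b - a) * (1 / ((N : ℝ) + 1))) atTop (𝓝 0) := by
    simpa using tendsto_one_div_add_atTop_nhds_zero_nat.const_mul (b - a)
  refine squeeze_zero (fun N => mesh_nonneg _) (fun N => ?_) h
  have : Nonempty (Fin (uniform hab N).n) := ⟨(0 : Fin (N + 1))⟩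
  refine ciSup_le fun i => ?_
  refine le_of_eq ?_
  change a + ((i : ℕ) + 1 : ℕ) * _ - (a + ((i : ℕ) : ℝ) * _) = _
  push_cast
  ring

end IntervalPartition

variable {E : Type*} [NormedAddCommGroup E]

/-- On `[a, b]`, a chain function takes at `t` the value with the index of the partition point
preceding `t`. -/
theorem exists_index_chainFun_eq (E : Type*) [NormedAddCommGroup E]
    (χ : IntervalPartition a b) {t : ℝ} (ht : t ∈ Icc a b) :
    ∃ i : Fin (χ.n + 1), χ.pt i ≤ t ∧ t - χ.mesh ≤ χ.pt i ∧
      ∀ y : Fin (χ.n + 1) → E, chainFun χ y t = y i := by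
  have hne : (Finset.univ.filter fun i => χ.pt i ≤ t).Nonempty :=
    ⟨0, by simp [χ.first, ht.1]⟩
  -- The index of the last partition point not exceeding `t`; it is the last index of all exactly
  -- when `t = b`.
  set i := (Finset.univ.filter fun i => χ.pt i ≤ t).max' hne with hi
  have hit : χ.pt i ≤ t := (Finset.mem_filter.1 (Finset.max'_mem _ hne)).2
  have hmax : ∀ j, i < j → t < χ.pt j := fun j hj => by
    by_contra! h
    exact absurd (Finset.le_max' (Finset.univ.filter fun i => χ.pt i ≤ t) j (by simpa using h))
      (not_le.2 hj)
  clear_value i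
  refine ⟨i, hit, ?_, ?_⟩
  · induction i using Fin.lastCases with
    | last => rw [χ.last]; linarith [ht.2, χ.mesh_nonneg]
    | cast j => linarith [χ.sub_le_mesh j, hmax j.succ j.castSucc_lt_succ]
  · intro y
    unfold chainFun
    induction i using Fin.lastCases with
    | last =>
      have htb : t = b := le_antisymm ht.2 (χ.last ▸ hit)
      rw [Finset.sum_eq_zero, zero_add, indicator_of_mem (by simp [htb])]
      intro j _
      refine indicator_of_notMem (fun h => ?_) _
      exact absurd ((χ.pt_mem j.succ).2) (not_le.2 (htb ▸ h.2))
    | cast j =>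
      have htj := hmax j.succ j.castSucc_lt_succ
      rw [Finset.sum_eq_single j, indicator_of_mem (show t ∈ Ico _ _ from ⟨hit, htj⟩),
        indicator_of_notMem, add_zero]
      · rintro rfl
        exact absurd ((χ.pt_mem j.succ).2) (not_le.2 htj)
      · intro k _ hk
        refine indicator_of_notMem (fun h => ?_) _
        rcases lt_or_gt_of_ne hk with h1 | h1
        · have : χ.pt k.succ ≤ χ.pt j.castSucc := χ.strictMono.monotone (by
            rw [Fin.le_def]; simpa using h1)
          linarith [h.2]
        · have : χ.pt j.succ ≤ χ.pt k.castSucc := χ.strictMono.monotone (by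
            rw [Fin.le_def]; simpa using h1)
          linarith [h.1]
      · simp

theorem stronglyMeasurable_chainFun (χ : IntervalPartition a b) (y : Fin (χ.n + 1) → E) :
    MeasureTheory.StronglyMeasurable (chainFun χ y) := by
  unfold chainFun
  refine MeasureTheory.StronglyMeasurable.add ?_
    (MeasureTheory.stronglyMeasurable_const.indicator (measurableSet_singleton b))
  exact Finset.stronglyMeasurable_fun_sum _ fun i _ =>
    MeasureTheory.stronglyMeasurable_const.indicator measurableSet_Ico

theorem integral_chainFun [NormedSpace ℝ E] [CompleteSpace E] (hab : a ≤ b) (χ : IntervalPartition a b)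
    (y : Fin (χ.n + 1) → E) :
    ∫ t in a..b, chainFun χ y t =
      ∑ i : Fin χ.n, (χ.pt i.succ - χ.pt i.castSucc) • y i.castSucc := by
  rw [intervalIntegral.integral_of_le hab, ← MeasureTheory.integral_Icc_eq_integral_Ioc]
  unfold chainFun
  have hI : ∀ s : Set ℝ, MeasurableSet s → ∀ c : E, MeasureTheory.Integrable
      (s.indicator fun _ => c) (MeasureTheory.volume.restrict (Icc a b)) := fun s hs c =>
    (MeasureTheory.integrable_const c).indicator hs
  rw [MeasureTheory.integral_add (MeasureTheory.integrable_finsetSum _ fun i _ =>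
      hI _ measurableSet_Ico _) (hI _ (measurableSet_singleton b) _),
    MeasureTheory.integral_finsetSum _ fun i _ => hI _ measurableSet_Ico _]
  rw [MeasureTheory.setIntegral_indicator (measurableSet_singleton b),
    MeasureTheory.setIntegral_measure_zero _
      (MeasureTheory.measure_mono_null inter_subset_right (by simp)), add_zero]
  refine Finset.sum_congr rfl fun i _ => ?_
  have h1 : Icc a b ∩ Ico (χ.pt i.castSucc) (χ.pt i.succ) = Ico (χ.pt i.castSucc) (χ.pt i.succ) :=
    inter_eq_right.2 fun t ht => ⟨(χ.pt_mem _).1.trans ht.1, ht.2.le.trans (χ.pt_mem _).2⟩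
  rw [MeasureTheory.setIntegral_indicator measurableSet_Ico, h1, MeasureTheory.setIntegral_const,
    Real.volume_real_Ico_of_le (χ.strictMono.monotone i.castSucc_lt_succ.le)]

/-- Weighted Riemann sums over chain functions that converge pointwise tend to the weighted
integral of the limit. -/
theorem tendsto_weightedSum_integral [NormedSpace ℝ E] [CompleteSpace E] (hab : a ≤ b) {k : ℝ → ℝ}
    (hk : Continuous k) {χ : ℕ → IntervalPartition a b} {y : ∀ j, Fin ((χ j).n + 1) → E}
    {s : ℝ → E} {R : ℝ} (hmesh : Tendsto (fun j => (χ j).mesh) atTop (𝓝 0))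
    (hR : ∀ j i, ‖y j i‖ ≤ R)
    (hs : ∀ t ∈ Icc a b, Tendsto (fun j => chainFun (χ j) (y j) t) atTop (𝓝 (s t))) :
    Tendsto (fun j => ∑ i : Fin (χ j).n, (((χ j).pt i.succ - (χ j).pt i.castSucc) *
      k ((χ j).pt i.castSucc)) • y j i.castSucc) atTop (𝓝 (∫ t in a..b, k t • s t)) := by
  obtain ⟨C, hC⟩ := (isCompact_Icc (a := a) (b := b)).exists_bound_of_continuousOn hk.continuousOn
  -- The weighted sum is exactly the integral of the step function with values `k(x_i) y_i`, so
  -- dominated convergence applies with the constant bound `C * R`. The partition points preceding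
  -- `t` tend to `t`, which turns `k(x_i)` into `k t`.
  have e : ∀ j, ∑ i : Fin (χ j).n, (((χ j).pt i.succ - (χ j).pt i.castSucc) *
      k ((χ j).pt i.castSucc)) • y j i.castSucc =
      ∫ t in a..b, chainFun (χ j) (fun i => k ((χ j).pt i) • y j i) t := fun j => by
    rw [integral_chainFun hab]
    simp only [mul_smul]
  simp only [e]
  refine intervalIntegral.tendsto_integral_filter_of_dominated_convergence (fun _ => C * R)
    (Eventually.of_forall fun j => (stronglyMeasurable_chainFun _ _).aestronglyMeasurable)
    (Eventually.of_forall fun j => Eventually.of_forall fun t ht => ?_)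
    intervalIntegrable_const (Eventually.of_forall fun t ht => ?_)
  · rw [uIoc_of_le hab] at ht
    obtain ⟨i, -, -, hi⟩ := exists_index_chainFun_eq E (χ j) (Ioc_subset_Icc_self ht)
    rw [hi, norm_smul]
    exact mul_le_mul (hC _ ((χ j).pt_mem i)) (hR j i) (norm_nonneg _)
      ((norm_nonneg _).trans (hC _ ((χ j).pt_mem i)))
  · rw [uIoc_of_le hab] at ht
    have ht' := Ioc_subset_Icc_self ht
    choose i hi1 hi2 hi3 using fun j => exists_index_chainFun_eq E (χ j) ht'
    have hpt : Tendsto (fun j => (χ j).pt (i j)) atTop (𝓝 t) :=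
      tendsto_of_tendsto_of_tendsto_of_le_of_le (by simpa using hmesh.const_sub t)
        tendsto_const_nhds hi2 hi1
    have := ((hk.tendsto t).comp hpt).smul (hs t ht')
    simpa only [hi3, Function.comp_def] using this

end Partition

/-! ### Metric chains: variation bounds, extension and compactness. -/

section Chains

variable {E : Type*} [NormedAddCommGroup E]

/-- One of the two points is nearest to the other, so their distance is a point-to-set distance,
which the Hausdorff distance dominates. Through this the bounded variation of `F` passes to chains.
-/
theorem norm_sub_le_dist_of_mem_metricPairs {A B : NonemptyCompacts E} {p q : E}
    (h : (p, q) ∈ metricPairs (A : Set E) (B : Set E)) : ‖p - q‖ ≤ dist A B := by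
  obtain ⟨hp, hq, h⟩ := h
  have fin : Metric.hausdorffEDist (A : Set E) B ≠ ⊤ :=
    Metric.hausdorffEDist_ne_top_of_nonempty_of_bounded A.nonempty B.nonempty
      A.isCompact.isBounded B.isCompact.isBounded
  rw [Metric.NonemptyCompacts.dist_eq, ← dist_eq_norm]
  rcases h with h | h
  · have h2 := h.2
    simp only at h2
    rw [dist_comm, h2, Metric.hausdorffDist_comm]
    exact Metric.infDist_le_hausdorffDist_of_mem hq (by rwa [Metric.hausdorffEDist_comm])
  · have h2 := h.2
    simp only at h2
    rw [h2]
    exact Metric.infDist_le_hausdorffDist_of_mem hp fin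

variable {a b : ℝ} {F : ℝ → NonemptyCompacts E}

theorem norm_chain_sub_le (hF : BoundedVariationOn F (Icc a b)) {χ : IntervalPartition a b}
    {y : Fin (χ.n + 1) → E} (hy : IsMetricChain (fun i => F (χ.pt i)) y) {i j : Fin (χ.n + 1)}
    (hij : i ≤ j) : ‖y i - y j‖ ≤ variationFun F a (χ.pt j) - variationFun F a (χ.pt i) := by
  induction j using Fin.induction with
  | zero =>
    have : i = 0 := le_antisymm hij (Fin.zero_le i)
    simp [this]
  | succ j ih =>
    rcases hij.eq_or_lt with rfl | hlt
    · simp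
    · have h1 := ih (by rw [Fin.le_def]; exact Nat.lt_succ_iff.1 (Fin.lt_def.1 hlt))
      have h2 := norm_sub_le_dist_of_mem_metricPairs (hy.2 j.castSucc j.succ (by simp))
      have h3 := dist_le_variationFun_sub hF (χ.pt_mem j.castSucc).1
        (χ.strictMono.monotone j.castSucc_lt_succ.le) (χ.pt_mem j.succ).2
      have h4 := norm_sub_le_norm_sub_add_norm_sub (y i) (y j.castSucc) (y j.succ)
      linarith

/-- The value at `u` is attached to a partition point that may precede `u` by as much as the mesh;
hence the shifted argument on the right. -/
theorem norm_chainFun_sub_le (hF : BoundedVariationOn F (Icc a b)) {χ : IntervalPartition a b}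
    {y : Fin (χ.n + 1) → E} (hy : IsMetricChain (fun i => F (χ.pt i)) y) {u v : ℝ}
    (hu : u ∈ Icc a b) (hv : v ∈ Icc a b) (huv : u ≤ v) :
    ‖chainFun χ y v - chainFun χ y u‖ ≤ extVariation F a b v - extVariation F a b (u - χ.mesh) := by
  obtain ⟨i, hi1, hi2, hi3⟩ := exists_index_chainFun_eq E χ hu
  obtain ⟨j, hj1, hj2, hj3⟩ := exists_index_chainFun_eq E χ hv
  have hmono := monotone_extVariation (hu.1.trans hu.2) hF
  rw [hi3, hj3]
  rcases le_total i j with h | h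
  · have := norm_chain_sub_le hF hy h
    rw [← extVariation_of_mem F (χ.pt_mem i), ← extVariation_of_mem F (χ.pt_mem j)] at this
    rw [norm_sub_rev]
    linarith [hmono hi2, hmono hj1]
  -- The order of the two indices has not been established, but in this case too both partition
  -- points lie between `u - χ.mesh` and `v`.
  · have := norm_chain_sub_le hF hy h
    rw [← extVariation_of_mem F (χ.pt_mem i), ← extVariation_of_mem F (χ.pt_mem j)] at this
    linarith [hmono (hi1.trans huv), hmono ((sub_le_sub_right huv χ.mesh).trans hj2)]

theorem exists_projection (p : E) (B : NonemptyCompacts E) : ∃ q, q ∈ projections p (B : Set E) := by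
  obtain ⟨q, hq, h⟩ := B.isCompact.exists_infDist_eq_dist B.nonempty p
  exact ⟨q, hq, h.symm⟩

/-- A nearest point to the last entry can always be appended. Riemann sums use chains on `x_0, …,
x_{n-1}` only, whereas a chain function also needs a value at `x_n`. -/
theorem exists_isMetricChain_extend {m : ℕ} (hm : m ≠ 0) {A : Fin (m + 1) → NonemptyCompacts E}
    {y : Fin m → E} (hy : IsMetricChain (fun i : Fin m => A i.castSucc) y) :
    ∃ z : Fin (m + 1) → E, IsMetricChain A z ∧ ∀ i : Fin m, z i.castSucc = y i := by
  obtain ⟨m, rfl⟩ := Nat.exists_eq_succ_of_ne_zero hm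
  obtain ⟨q, hq⟩ := exists_projection (y (Fin.last m)) (A (Fin.last (m + 1)))
  refine ⟨Fin.snoc (α := fun _ => E) y q, ⟨fun i => ?_, fun i j hij => ?_⟩, fun i => by simp⟩
  · induction i using Fin.lastCases with
    | last => simpa using hq.1
    | cast i => simpa using hy.1 i
  · induction i using Fin.lastCases with
    | last => have := j.isLt; simp at hij; omega
    | cast i =>
      induction j using Fin.lastCases with
      | last =>
        have hi : i = Fin.last m := by
          ext; simpa using hij
        subst hi
        simp only [Fin.snoc_castSucc, Fin.snoc_last]
        exact ⟨hy.1 _, hq.1, Or.inr hq⟩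
      | cast j =>
        simp only [Fin.snoc_castSucc]
        exact hy.2 i j (by simpa using hij)

theorem exists_isMetricChain : ∀ {m : ℕ} (A : Fin m → NonemptyCompacts E),
    ∃ y : Fin m → E, IsMetricChain A y
  | 0, A => ⟨Fin.elim0, fun i => i.elim0, fun i => i.elim0⟩
  | 1, A => by
    obtain ⟨q, hq⟩ := (A 0).nonempty
    refine ⟨fun _ => q, fun i => by rw [Subsingleton.elim i 0]; exact hq, fun i j hij => ?_⟩
    omega
  | m + 2, A => by
    obtain ⟨y, hy⟩ := exists_isMetricChain fun i : Fin (m + 1) => A i.castSucc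
    obtain ⟨z, hz, -⟩ := exists_isMetricChain_extend m.succ_ne_zero hy
    exact ⟨z, hz⟩

theorem IsMetricChain.castSucc {m : ℕ} {A : Fin (m + 1) → NonemptyCompacts E}
    {y : Fin (m + 1) → E} (hy : IsMetricChain A y) :
    IsMetricChain (fun i : Fin m => A i.castSucc) (fun i => y i.castSucc) :=
  ⟨fun i => hy.1 _, fun i j hij => hy.2 _ _ (by simpa using hij)⟩

theorem exists_norm_le_of_mem (hF : IsBVCompactGraph a b F) :
    ∃ R, ∀ t ∈ Icc a b, ∀ y ∈ F t, ‖y‖ ≤ R := by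
  obtain ⟨R, hR⟩ := hF.isCompact_graph.isBounded.exists_norm_le
  exact ⟨R, fun t ht y hy => (le_max_right _ _).trans (hR (t, y) ⟨ht, hy⟩)⟩

/-- Helly's selection principle for chain functions. -/
theorem exists_subseq_tendsto_chainFun [NormedSpace ℝ E] [FiniteDimensional ℝ E] (hF : IsBVCompactGraph a b F)
    {χ : ℕ → IntervalPartition a b} {y : ∀ j, Fin ((χ j).n + 1) → E}
    (hmesh : Tendsto (fun j => (χ j).mesh) atTop (𝓝 0))
    (hy : ∀ j, IsMetricChain (fun i => F ((χ j).pt i)) (y j)) :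
    ∃ φ : ℕ → ℕ, StrictMono φ ∧ ∃ s : ℝ → E, (∀ t ∈ Icc a b, s t ∈ F t) ∧
      ∀ t ∈ Icc a b, Tendsto (fun j => chainFun (χ (φ j)) (y (φ j)) t) atTop (𝓝 (s t)) := by
  have := FiniteDimensional.proper_real E
  obtain ⟨R, hR⟩ := exists_norm_le_of_mem hF
  have hab : a ≤ b := ((χ 0).pt_mem 0).1.trans ((χ 0).pt_mem 0).2
  have hmono := monotone_extVariation hab hF.boundedVariation
  set V := extVariation F a b with hV
  -- Convergence is forced by compactness on a countable set: a dense set, the discontinuities of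
  -- `V`, and `b`, which has no rational to its right in `[a, b]`.
  set D : Set ℝ := ({b} ∪ range ((↑) : ℚ → ℝ) ∪ {t | ¬ ContinuousAt V t}) ∩ Icc a b with hD
  have hDc : D.Countable := (((countable_singleton b).union (countable_range _)).union
    hmono.countable_not_continuousAt).mono inter_subset_left
  have : Countable D := hDc.to_subtype
  have hcpt : IsCompact (Set.pi univ fun _ : D => Metric.closedBall (0 : E) R) :=
    isCompact_univ_pi fun _ => isCompact_closedBall _ _
  obtain ⟨g, -, φ, hφ, hg⟩ := hcpt.tendsto_subseq
    (x := fun j (t : D) => chainFun (χ j) (y j) t) (fun j t _ => by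
      obtain ⟨i, -, -, hi⟩ := exists_index_chainFun_eq E (χ j) t.2.2
      change chainFun (χ j) (y j) t ∈ Metric.closedBall 0 R
      rw [hi, mem_closedBall_zero_iff]
      exact hR _ ((χ j).pt_mem i) _ ((hy j).1 i))
  have hgD : ∀ t ∈ D, CauchySeq fun j => chainFun (χ (φ j)) (y (φ j)) t := fun t ht =>
    (tendsto_pi_nhds.1 hg ⟨t, ht⟩).cauchySeq
  have hmφ : Tendsto (fun j => (χ (φ j)).mesh) atTop (𝓝 0) := hmesh.comp hφ.tendsto_atTop
  have hcauchy : ∀ t ∈ Icc a b, CauchySeq fun j => chainFun (χ (φ j)) (y (φ j)) t := by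
    intro t ht
    by_cases htD : t ∈ D
    · exact hgD t htD
    have htc : ContinuousAt V t := by
      by_contra h
      exact htD ⟨Or.inr h, ht⟩
    have htb : t < b := ht.2.lt_of_ne fun h => htD ⟨Or.inl (Or.inl h), ht⟩
    rw [Metric.cauchySeq_iff']
    intro ε hε
    obtain ⟨η, hη, hcont⟩ := Metric.continuousAt_iff.1 htc (ε / 8) (by positivity)
    -- At a continuity point of `V`, all chain functions of small mesh vary by at most `ε / 4`
    -- between `t` and a nearby rational `q > t`, so the Cauchy property is inherited from `q`.
    obtain ⟨q, hq1, hq2⟩ := exists_rat_btwn (lt_min htb (lt_add_of_pos_right t hη))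
    have hqI : (q : ℝ) ∈ Icc a b := ⟨ht.1.trans hq1.le, (hq2.le.trans (min_le_left _ _))⟩
    have hqD : (q : ℝ) ∈ D := ⟨Or.inl (Or.inr ⟨q, rfl⟩), hqI⟩
    obtain ⟨N₁, hN₁⟩ := Metric.cauchySeq_iff'.1 (hgD q hqD) (ε / 4) (by positivity)
    obtain ⟨N₂, hN₂⟩ := eventually_atTop.1 (hmφ.eventually_lt_const hη)
    have hVq : V q < V t + ε / 8 := by
      have := hcont (x := q) (by
        rw [Real.dist_eq, abs_of_pos (sub_pos.2 hq1)]
        linarith [hq2.trans_le (min_le_right _ _)])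
      rw [Real.dist_eq] at this
      linarith [(abs_lt.1 this).2]
    have hclose : ∀ j ≥ N₂, dist (chainFun (χ (φ j)) (y (φ j)) q) (chainFun (χ (φ j)) (y (φ j)) t)
        ≤ ε / 4 := by
      intro j hj
      rw [dist_eq_norm]
      refine (norm_chainFun_sub_le hF.boundedVariation (hy _) ht hqI hq1.le).trans ?_
      have := hcont (x := t - (χ (φ j)).mesh) (by
        rw [Real.dist_eq, sub_sub_cancel_left, abs_neg, abs_of_nonneg (χ (φ j)).mesh_nonneg]
        exact hN₂ j hj)
      rw [Real.dist_eq] at this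
      linarith [(abs_lt.1 this).1]
    refine ⟨max N₁ N₂, fun j hj => ?_⟩
    have h1 := hclose j ((le_max_right _ _).trans hj)
    have h2 := hclose (max N₁ N₂) (le_max_right _ _)
    have h3 := hN₁ j ((le_max_left _ _).trans hj)
    have h4 := hN₁ (max N₁ N₂) (le_max_left _ _)
    have t1 := dist_triangle4 (chainFun (χ (φ j)) (y (φ j)) t) (chainFun (χ (φ j)) (y (φ j)) q)
      (chainFun (χ (φ (max N₁ N₂))) (y (φ (max N₁ N₂))) q)
      (chainFun (χ (φ (max N₁ N₂))) (y (φ (max N₁ N₂))) t)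
    have t2 := dist_triangle_right (chainFun (χ (φ j)) (y (φ j)) q)
      (chainFun (χ (φ (max N₁ N₂))) (y (φ (max N₁ N₂))) q) (chainFun (χ (φ N₁)) (y (φ N₁)) q)
    rw [dist_comm (chainFun (χ (φ j)) (y (φ j)) t) (chainFun (χ (φ j)) (y (φ j)) q)] at t1
    linarith
  choose! s hs using fun t ht => cauchySeq_tendsto_of_complete (hcauchy t ht)
  refine ⟨φ, hφ, s, fun t ht => ?_, hs⟩
  choose i hi1 hi2 hi3 using fun j => exists_index_chainFun_eq E (χ (φ j)) ht
  have hpt : Tendsto (fun j => (χ (φ j)).pt (i j)) atTop (𝓝 t) :=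
    tendsto_of_tendsto_of_tendsto_of_le_of_le (by simpa using hmφ.const_sub t)
      tendsto_const_nhds hi2 hi1
  have hval : Tendsto (fun j => y (φ j) (i j)) atTop (𝓝 (s t)) := by
    simpa only [hi3] using hs t ht
  -- The points `(x_i, y_i)` of the graph converge to `(t, s t)`, so closedness of the graph makes
  -- the limit a selection.
  exact (hF.isCompact_graph.isClosed.mem_of_tendsto (hpt.prodMk_nhds hval)
    (Eventually.of_forall fun j => ⟨(χ (φ j)).pt_mem _, (hy (φ j)).1 _⟩)).2

/-- A limit of chain functions is controlled by the variation function of `F`. -/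
theorem norm_limit_chainFun_sub_le (hF : BoundedVariationOn F (Icc a b))
    {χ : ℕ → IntervalPartition a b} {y : ∀ j, Fin ((χ j).n + 1) → E} {s : ℝ → E}
    (hmesh : Tendsto (fun j => (χ j).mesh) atTop (𝓝 0))
    (hy : ∀ j, IsMetricChain (fun i => F ((χ j).pt i)) (y j))
    (hs : ∀ t ∈ Icc a b, Tendsto (fun j => chainFun (χ j) (y j) t) atTop (𝓝 (s t)))
    {u v : ℝ} (hu : u ∈ Icc a b) (hv : v ∈ Icc a b) (huv : u ≤ v) :
    ‖s v - s u‖ ≤ (extVariation F a b v + Function.leftLim (extVariation F a b) v) -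
      (extVariation F a b u + Function.leftLim (extVariation F a b) u) := by
  have hmono := monotone_extVariation (hu.1.trans hu.2) hF
  rcases huv.eq_or_lt with rfl | hlt
  · simp
  -- The shift by the mesh survives in the limit as a left limit, giving `V v - V (u - 0)`, which is
  -- not an increment of one function. Adding `V (v - 0) - V u`, nonnegative for `u < v`, makes it
  -- an increment of `V + V (· - 0)`.
  have h1 : ∀ p < u, ‖s v - s u‖ ≤ extVariation F a b v - extVariation F a b p := by
    intro p hp
    refine le_of_tendsto ((hs v hv).sub (hs u hu)).norm ?_
    filter_upwards [hmesh.eventually_lt_const (sub_pos.2 hp)] with j hj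
    refine (norm_chainFun_sub_le hF (hy j) hu hv huv).trans ?_
    have := hmono (show p ≤ u - (χ j).mesh by linarith)
    linarith
  have h2 : ‖s v - s u‖ ≤ extVariation F a b v - Function.leftLim (extVariation F a b) u :=
    ge_of_tendsto ((hmono.tendsto_leftLim u).const_sub _)
      (eventually_nhdsWithin_of_forall fun p hp => h1 p hp)
  linarith [hmono.le_leftLim hlt]

end Chains

end MetricFourier

namespace MetricFourier

/-! ### One-sided limits of functions controlled by a monotone function. -/

section OneSidedLimits

variable {E : Type*} [NormedAddCommGroup E] {f : ℝ → E} {w : ℝ → ℝ} {a b x : ℝ}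

/-- The right limit of the monotone `w` gives the Cauchy criterion for `f`. Existence must be
proved, since `Function.rightLim` returns `f x` when there is no limit. -/
theorem tendsto_rightLim_of_control [CompleteSpace E] (hwm : Monotone w)
    (hw : ∀ u ∈ Icc a b, ∀ v ∈ Icc a b, u ≤ v → ‖f v - f u‖ ≤ w v - w u) (hx : x ∈ Ioo a b) :
    Tendsto f (𝓝[>] x) (𝓝 (Function.rightLim f x)) := by
  suffices h : ∃ c, Tendsto f (𝓝[>] x) (𝓝 c) from tendsto_rightLim_of_tendsto h
  refine cauchy_map_iff_exists_tendsto.1 (Metric.cauchy_iff.2 ⟨inferInstance, fun ε hε => ?_⟩)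
  have hlt : ∀ᶠ t in 𝓝[>] x, w t < Function.rightLim w x + ε :=
    (hwm.tendsto_rightLim x).eventually_lt_const (by linarith)
  have hIoo : ∀ᶠ t in 𝓝[>] x, t ∈ Ioo x b := Ioo_mem_nhdsGT hx.2
  refine ⟨_, image_mem_map (hlt.and hIoo), ?_⟩
  have key : ∀ u v, (w u < Function.rightLim w x + ε ∧ u ∈ Ioo x b) →
      (w v < Function.rightLim w x + ε ∧ v ∈ Ioo x b) → u ≤ v → dist (f v) (f u) < ε := by
    intro u v hu hv huv
    rw [dist_eq_norm]
    have := hw u ⟨(hx.1.trans hu.2.1).le, hu.2.2.le⟩ v ⟨(hx.1.trans hv.2.1).le, hv.2.2.le⟩ huv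
    linarith [hwm.rightLim_le hu.2.1]
  rintro _ ⟨u, hu, rfl⟩ _ ⟨v, hv, rfl⟩
  rcases le_total u v with h | h
  · rw [dist_comm]; exact key u v hu hv h
  · exact key v u hv hu h

theorem tendsto_leftLim_of_control [CompleteSpace E] (hwm : Monotone w)
    (hw : ∀ u ∈ Icc a b, ∀ v ∈ Icc a b, u ≤ v → ‖f v - f u‖ ≤ w v - w u) (hx : x ∈ Ioo a b) :
    Tendsto f (𝓝[<] x) (𝓝 (Function.leftLim f x)) := by
  suffices h : ∃ c, Tendsto f (𝓝[<] x) (𝓝 c) from tendsto_leftLim_of_tendsto h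
  refine cauchy_map_iff_exists_tendsto.1 (Metric.cauchy_iff.2 ⟨inferInstance, fun ε hε => ?_⟩)
  have hlt : ∀ᶠ t in 𝓝[<] x, Function.leftLim w x - ε < w t :=
    (hwm.tendsto_leftLim x).eventually_const_lt (by linarith)
  have hIoo : ∀ᶠ t in 𝓝[<] x, t ∈ Ioo a x := Ioo_mem_nhdsLT hx.1
  refine ⟨_, image_mem_map (hlt.and hIoo), ?_⟩
  have key : ∀ u v, (Function.leftLim w x - ε < w u ∧ u ∈ Ioo a x) →
      (Function.leftLim w x - ε < w v ∧ v ∈ Ioo a x) → u ≤ v → dist (f v) (f u) < ε := by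
    intro u v hu hv huv
    rw [dist_eq_norm]
    have := hw u ⟨hu.2.1.le, (hu.2.2.trans hx.2).le⟩ v ⟨hv.2.1.le, (hv.2.2.trans hx.2).le⟩ huv
    linarith [hwm.le_leftLim hv.2.2]
  rintro _ ⟨u, hu, rfl⟩ _ ⟨v, hv, rfl⟩
  rcases le_total u v with h | h
  · rw [dist_comm]; exact key u v hu hv h
  · exact key v u hv hu h

theorem norm_sub_rightLim_le [CompleteSpace E] (hwm : Monotone w)
    (hw : ∀ u ∈ Icc a b, ∀ v ∈ Icc a b, u ≤ v → ‖f v - f u‖ ≤ w v - w u) (hx : x ∈ Ioo a b)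
    {v : ℝ} (hxv : x < v) (hv : v ≤ b) :
    ‖f v - Function.rightLim f x‖ ≤ w v - Function.rightLim w x := by
  refine le_of_tendsto_of_tendsto ((tendsto_rightLim_of_control hwm hw hx).const_sub _).norm
    ((hwm.tendsto_rightLim x).const_sub _) ?_
  filter_upwards [Ioo_mem_nhdsGT hxv] with t ht
  exact hw t ⟨(hx.1.trans ht.1).le, ht.2.le.trans hv⟩ v ⟨(hx.1.trans hxv).le, hv⟩ ht.2.le

theorem norm_leftLim_sub_le [CompleteSpace E] (hwm : Monotone w)
    (hw : ∀ u ∈ Icc a b, ∀ v ∈ Icc a b, u ≤ v → ‖f v - f u‖ ≤ w v - w u) (hx : x ∈ Ioo a b)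
    {u : ℝ} (hu : a ≤ u) (hux : u < x) :
    ‖Function.leftLim f x - f u‖ ≤ Function.leftLim w x - w u := by
  refine le_of_tendsto_of_tendsto ((tendsto_leftLim_of_control hwm hw hx).sub_const _).norm
    ((hwm.tendsto_leftLim x).sub_const _) ?_
  filter_upwards [Ioo_mem_nhdsLT hux] with t ht
  exact hw u ⟨hu, (hux.trans hx.2).le⟩ t ⟨hu.trans ht.1.le, (ht.2.trans hx.2).le⟩ ht.1.le

end OneSidedLimits

/-! ### Abel estimates on the intervals adjacent to `x`. -/

section LocalEstimates

variable {E : Type*} [NormedAddCommGroup E] [NormedSpace ℝ E] [CompleteSpace E]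
  {f : ℝ → E} {φ w : ℝ → ℝ} {a b x δ M : ℝ}

/-- Replacing the values of `f` and `w` at `x` by their right limits leaves the integral unchanged
and removes the jump at `x` from the bound. The subtracted constant is then the value at the base
point, so Abel's inequality has no boundary term. -/
theorem norm_integral_smul_sub_rightLim_le (hwm : Monotone w)
    (hw : ∀ u ∈ Icc a b, ∀ v ∈ Icc a b, u ≤ v → ‖f v - f u‖ ≤ w v - w u) (hx : x ∈ Ioo a b)
    (hδ : 0 < δ) (hδb : x + δ ≤ b) (hφ : Continuous φ)
    (hM : ∀ u ∈ Icc x (x + δ), |∫ t in u..x + δ, φ t| ≤ M)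
    (hf : IntervalIntegrable f MeasureTheory.volume x (x + δ)) :
    ‖∫ t in x..x + δ, φ t • (f t - Function.rightLim f x)‖ ≤
      M * (w (x + δ) - Function.rightLim w x) := by
  have hxδ : x < x + δ := by linarith
  set g := Function.update f x (Function.rightLim f x) with hg
  have hgf : ∀ t, x < t → g t = f t := fun t ht => Function.update_of_ne ht.ne' _ _
  have h := norm_integral_smul_sub_const_le (f := g) (w := Function.update w x (Function.rightLim w x))
    hxδ.le hφ hM (hf.congr fun t ht => by
      rw [uIoc_of_le hxδ.le] at ht; exact (hgf t ht.1).symm)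
    (fun u hu v hv huv => by
      rcases hu.1.eq_or_lt with rfl | hxu
      · rcases huv.eq_or_lt with rfl | hxv
        · simp
        · rw [hgf v hxv, hg, Function.update_self, Function.update_self,
            Function.update_of_ne hxv.ne']
          exact norm_sub_rightLim_le hwm hw hx hxv (hv.2.trans hδb)
      · have hxv := hxu.trans_le huv
        rw [hgf v hxv, hgf u hxu, Function.update_of_ne hxv.ne', Function.update_of_ne hxu.ne']
        exact hw u ⟨(hx.1.trans hxu).le, hu.2.trans hδb⟩ v ⟨(hx.1.trans hxv).le, hv.2.trans hδb⟩ huv)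
    (Function.rightLim f x)
  rw [Function.update_self, Function.update_of_ne hxδ.ne', hg, Function.update_self, sub_self,
    norm_zero, add_zero, ← hg] at h
  refine le_trans (le_of_eq ?_) h
  congr 1
  refine intervalIntegral.integral_congr_ae (Eventually.of_forall fun t ht => ?_)
  rw [uIoc_of_le hxδ.le] at ht
  rw [hgf t ht.1]

/-- The factor `2` arises because Abel's inequality is based at the left endpoint `x - δ` while the
subtracted constant is the limit at the right one; the boundary term costs one more increment of
`w`. -/
theorem norm_integral_smul_sub_leftLim_le (hwm : Monotone w)
    (hw : ∀ u ∈ Icc a b, ∀ v ∈ Icc a b, u ≤ v → ‖f v - f u‖ ≤ w v - w u) (hx : x ∈ Ioo a b)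
    (hδ : 0 < δ) (hδa : a ≤ x - δ) (hφ : Continuous φ)
    (hM : ∀ u ∈ Icc (x - δ) x, |∫ t in u..x, φ t| ≤ M)
    (hf : IntervalIntegrable f MeasureTheory.volume (x - δ) x) :
    ‖∫ t in (x - δ)..x, φ t • (f t - Function.leftLim f x)‖ ≤
      2 * M * (Function.leftLim w x - w (x - δ)) := by
  have hxδ : x - δ < x := by linarith
  set g := Function.update f x (Function.leftLim f x) with hg
  have hgf : ∀ t, t < x → g t = f t := fun t ht => Function.update_of_ne ht.ne _ _
  have hne : ∀ᵐ t : ℝ, t ≠ x := by simp [MeasureTheory.ae_iff]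
  have hae : ∀ᵐ t : ℝ, t ∈ uIoc (x - δ) x → f t = g t := by
    filter_upwards [hne] with t ht h
    rw [uIoc_of_le hxδ.le] at h
    exact (hgf t (h.2.lt_of_ne ht)).symm
  have h := norm_integral_smul_sub_const_le (f := g) (w := Function.update w x (Function.leftLim w x))
    hxδ.le hφ hM (hf.congr_ae ((MeasureTheory.ae_restrict_iff' measurableSet_uIoc).2 hae))
    (fun u hu v hv huv => by
      rcases hv.2.eq_or_lt with rfl | hvx
      · rcases huv.eq_or_lt with rfl | hux
        · simp
        · rw [hgf u hux, hg, Function.update_self, Function.update_self,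
            Function.update_of_ne hux.ne]
          exact norm_leftLim_sub_le hwm hw hx (hδa.trans hu.1) hux
      · have hux := huv.trans_lt hvx
        rw [hgf v hvx, hgf u hux, Function.update_of_ne hvx.ne, Function.update_of_ne hux.ne]
        exact hw u ⟨hδa.trans hu.1, (hux.trans hx.2).le⟩ v
          ⟨hδa.trans hv.1, (hvx.trans hx.2).le⟩ huv)
    (Function.leftLim f x)
  rw [Function.update_self, Function.update_of_ne hxδ.ne, hgf _ hxδ, norm_sub_rev] at h
  have h2 := norm_leftLim_sub_le hwm hw hx hδa hxδ
  have hM0 : 0 ≤ M := (abs_nonneg _).trans (hM x ⟨hxδ.le, le_rfl⟩)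
  have e : ∫ t in (x - δ)..x, φ t • (f t - Function.leftLim f x) =
      ∫ t in (x - δ)..x, φ t • (g t - Function.leftLim f x) := by
    refine intervalIntegral.integral_congr_ae ?_
    filter_upwards [hae] with t ht h
    rw [ht h]
  rw [e]
  refine h.trans ?_
  nlinarith

end LocalEstimates

/-! ### The quantitative Dirichlet–Jordan theorem. -/

section FourierSeries

theorem integral_dirichletKernel_sub_left (n : ℕ) (x u v : ℝ) :
    ∫ t in u..v, dirichletKernel n (x - t) = ∫ t in (x - v)..(x - u), dirichletKernel n t :=
  intervalIntegral.integral_comp_sub_left (dirichletKernel n) x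

theorem integral_dirichletKernel_sub_left' (n : ℕ) (x u v : ℝ) :
    ∫ t in u..v, dirichletKernel n (x - t) = ∫ t in (u - x)..(v - x), dirichletKernel n t := by
  rw [integral_dirichletKernel_sub_left, ← neg_sub v x, ← neg_sub u x, integral_dirichletKernel_neg]

theorem integral_dirichletKernel_sub_left_period (n : ℕ) (x : ℝ) :
    ∫ t in -Real.pi..Real.pi, dirichletKernel n (x - t) = Real.pi := by
  have hper : Function.Periodic (dirichletKernel n) (2 * Real.pi) := dirichletKernel_add_two_pi n
  have h := hper.intervalIntegral_add_eq (x - Real.pi) (-Real.pi)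
  have e1 : x - Real.pi + 2 * Real.pi = x - -Real.pi := by ring
  have e2 : -Real.pi + 2 * Real.pi = Real.pi := by ring
  have hc := continuous_dirichletKernel n
  have h3 := integral_dirichletKernel_neg n Real.pi 0
  rw [neg_zero, integral_dirichletKernel_zero_pi] at h3
  rw [integral_dirichletKernel_sub_left, ← e1, h, e2,
    ← intervalIntegral.integral_add_adjacent_intervals (hc.intervalIntegrable _ 0)
      (hc.intervalIntegrable 0 _), h3, integral_dirichletKernel_zero_pi]
  ring

variable {E : Type*} [NormedAddCommGroup E] [NormedSpace ℝ E]

theorem integral_eq_add_add_add {g : ℝ → E} {a b c d e : ℝ}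
    (hg : IntervalIntegrable g MeasureTheory.volume a e) (hab : a ≤ b) (hbc : b ≤ c) (hcd : c ≤ d)
    (hde : d ≤ e) :
    ∫ t in a..e, g t =
      (∫ t in a..b, g t) + (∫ t in b..c, g t) + (∫ t in c..d, g t) + ∫ t in d..e, g t := by
  have hgI : ∀ {u v}, a ≤ u → u ≤ v → v ≤ e →
      IntervalIntegrable g MeasureTheory.volume u v := fun {u v} hu huv hv =>
    hg.mono_set (by
      rw [uIcc_of_le huv, uIcc_of_le (hu.trans (huv.trans hv))]; exact Icc_subset_Icc hu hv)
  have g1 := hgI le_rfl hab (by linarith)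
  have g2 := hgI hab hbc (by linarith)
  have g3 := hgI (by linarith) hcd hde
  have g4 := hgI (by linarith) hde le_rfl
  rw [intervalIntegral.integral_add_adjacent_intervals g1 g2,
    intervalIntegral.integral_add_adjacent_intervals (g1.trans g2) g3,
    intervalIntegral.integral_add_adjacent_intervals ((g1.trans g2).trans g3) g4]

/-- The quantitative Dirichlet-Jordan theorem for functions whose variation is controlled
by `w`. -/
theorem norm_fourier_sub_le [CompleteSpace E] {f : ℝ → E} {w : ℝ → ℝ} {x δ : ℝ} {n : ℕ} (hwm : Monotone w)
    (hw : ∀ u ∈ Icc (-Real.pi) Real.pi, ∀ v ∈ Icc (-Real.pi) Real.pi, u ≤ v →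
      ‖f v - f u‖ ≤ w v - w u)
    (hf : IntervalIntegrable f MeasureTheory.volume (-Real.pi) Real.pi)
    (hx : x ∈ Ioo (-Real.pi) Real.pi) (hδ : 0 < δ) (hδl : -Real.pi ≤ x - δ)
    (hδr : x + δ ≤ Real.pi) (hn : 1 ≤ n) :
    ‖(1 / Real.pi) • (∫ t in -Real.pi..Real.pi, dirichletKernel n (x - t) • f t) -
        (1 / 2 : ℝ) • (Function.rightLim f x + Function.leftLim f x)‖ ≤
      5 * (1 / n * (1 + 6 * Real.cot (δ / 2)) * (w Real.pi - w (-Real.pi))) +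
        30 * (w (x + δ) - Function.rightLim w x) +
        60 * (Function.leftLim w x - w (x - δ)) := by
  have hpi := Real.pi_pos
  have hδπ : δ ≤ Real.pi := by linarith
  set B : ℝ := 1 / n * (1 + 6 * Real.cot (δ / 2)) with hB
  have hB0 : 0 ≤ B := mul_nonneg (by positivity)
    (by linarith [cot_nonneg (p := δ / 2) (by linarith) (by linarith)])
  set r := Function.rightLim f x
  set l := Function.leftLim f x
  set φ : ℝ → ℝ := fun t => dirichletKernel n (x - t) with hφd
  have hφ : Continuous φ := (continuous_dirichletKernel n).comp (by fun_prop)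
  have hmem : ∀ {t}, -Real.pi ≤ t → t ≤ Real.pi → t ∈ Icc (-Real.pi) Real.pi := fun h h' => ⟨h, h'⟩
  have hfI : ∀ {u v}, -Real.pi ≤ u → u ≤ v → v ≤ Real.pi →
      IntervalIntegrable f MeasureTheory.volume u v := fun {u v} hu huv hv =>
    hf.mono_set (by rw [uIcc_of_le huv, uIcc_of_le (by linarith)]; exact Icc_subset_Icc hu hv)
  have hφI : ∀ {u v}, IntervalIntegrable φ MeasureTheory.volume u v := hφ.intervalIntegrable _ _
  have near_r := norm_integral_smul_sub_rightLim_le (M := 30) hwm hw hx hδ hδr hφ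
    (fun u hu => by
      rw [integral_dirichletKernel_sub_left']
      exact abs_integral_dirichletKernel_le hn (by linarith [hu.1]) (by linarith [hu.2])
        (by linarith)) (hfI hx.1.le (by linarith) hδr)
  have near_l := norm_integral_smul_sub_leftLim_le (M := 30) hwm hw hx hδ hδl hφ
    (fun u hu => by
      rw [integral_dirichletKernel_sub_left]
      exact abs_integral_dirichletKernel_le hn (by linarith) (by linarith [hu.2])
        (by linarith [hu.1])) (hfI hδl (by linarith) hx.2.le)
  have far_r := norm_integral_smul_sub_const_le (M := B) hδr hφ
    (fun u hu => by
      rw [integral_dirichletKernel_sub_left']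
      exact abs_integral_dirichletKernel_le_cot hn hδ hδπ (by linarith [hu.1]) (by linarith [hu.2])
        (by linarith)) (hfI (by linarith [hx.1]) hδr le_rfl) (w := w)
    (fun u hu v hv => hw u (hmem (by linarith [hu.1, hx.1]) hu.2) v
      (hmem (by linarith [hv.1, hx.1]) hv.2)) (f x)
  have far_l := norm_integral_smul_sub_const_le (M := B) hδl hφ
    (fun u hu => by
      rw [integral_dirichletKernel_sub_left]
      exact abs_integral_dirichletKernel_le_cot hn hδ hδπ (by linarith [hu.1]) (by linarith [hu.2])
        (by linarith [hu.1])) (hfI le_rfl hδl (by linarith [hx.2])) (w := w)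
    (fun u hu v hv => hw u (hmem hu.1 (by linarith [hu.2, hx.2])) v
      (hmem hv.1 (by linarith [hv.2, hx.2]))) (f x)
  have hwx_r := hw x (hmem hx.1.le hx.2.le) (x + δ) (hmem (by linarith [hx.1]) hδr) (by linarith)
  have hwx_l := hw (-Real.pi) (hmem le_rfl (by linarith)) x (hmem hx.1.le hx.2.le) hx.1.le
  rw [norm_sub_rev] at hwx_l
  have hw1 : w (-Real.pi) ≤ w (x - δ) := hwm hδl
  have hw2 : w (x - δ) ≤ w x := hwm (by linarith)
  have hw3 : w x ≤ w (x + δ) := hwm (by linarith)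
  have hw4 : w (x + δ) ≤ w Real.pi := hwm hδr
  have far_r' : ‖∫ t in (x + δ)..Real.pi, φ t • (f t - f x)‖ ≤ B * (w Real.pi - w (-Real.pi)) :=
    far_r.trans (mul_le_mul_of_nonneg_left (by linarith) hB0)
  -- The factor `2` again comes from the base point, here `-π`, being the endpoint far from `x`.
  have far_l' : ‖∫ t in -Real.pi..(x - δ), φ t • (f t - f x)‖ ≤
      2 * (B * (w Real.pi - w (-Real.pi))) := by
    refine far_l.trans ((mul_le_mul_of_nonneg_left
      (show _ ≤ 2 * (w Real.pi - w (-Real.pi)) by linarith) hB0).trans_eq (by ring))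
  have hr : ‖r - f x‖ ≤ w Real.pi - w (-Real.pi) := by
    refine le_of_tendsto ((tendsto_rightLim_of_control hwm hw hx).sub_const _).norm ?_
    filter_upwards [Ioo_mem_nhdsGT hx.2] with t ht
    have h1 := hw x (hmem hx.1.le hx.2.le) t (hmem (hx.1.trans ht.1).le ht.2.le) ht.1.le
    linarith [hwm ht.2.le]
  have hl : ‖l - f x‖ ≤ w Real.pi - w (-Real.pi) := by
    refine le_of_tendsto ((tendsto_leftLim_of_control hwm hw hx).sub_const _).norm ?_
    filter_upwards [Ioo_mem_nhdsLT hx.1] with t ht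
    have h1 := hw t (hmem ht.1.le (ht.2.trans hx.2).le) x (hmem hx.1.le hx.2.le) ht.2.le
    rw [norm_sub_rev] at h1
    linarith [hwm ht.1.le]
  set I := ∫ t in (0 : ℝ)..δ, dirichletKernel n t with hI
  have hIr : ∫ t in x..x + δ, φ t = I := by
    rw [hφd, integral_dirichletKernel_sub_left']; simp [hI]
  have hIl : ∫ t in (x - δ)..x, φ t = I := by
    rw [hφd, integral_dirichletKernel_sub_left]; simp [hI]
  have hIπ : |I - Real.pi / 2| ≤ B := by
    have hc := continuous_dirichletKernel n
    rw [← integral_dirichletKernel_zero_pi n, ← intervalIntegral.integral_add_adjacent_intervals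
      (hc.intervalIntegrable 0 δ) (hc.intervalIntegrable δ Real.pi), sub_add_cancel_left, abs_neg]
    exact abs_integral_dirichletKernel_le_cot hn hδ hδπ le_rfl hδπ (by linarith)
  have hφf : ∀ {u v}, -Real.pi ≤ u → u ≤ v → v ≤ Real.pi → ∀ c : E,
      ∫ t in u..v, φ t • f t = (∫ t in u..v, φ t • (f t - c)) + (∫ t in u..v, φ t) • c := by
    intro u v hu huv hv c
    rw [← intervalIntegral.integral_smul_const, ← intervalIntegral.integral_add
      (((hfI hu huv hv).sub intervalIntegrable_const).continuousOn_smul hφ.continuousOn)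
      (intervalIntegrable_const.continuousOn_smul hφ.continuousOn)]
    simp only [smul_sub, sub_add_cancel]
  have hxl : x - δ ≤ x := by linarith
  have hxr : x ≤ x + δ := by linarith
  have htot := integral_eq_add_add_add (g := φ) hφI hδl hxl hxr hδr
  rw [hφd, integral_dirichletKernel_sub_left_period, ← hφd, hIr, hIl] at htot
  have hsplit := integral_eq_add_add_add (hf.continuousOn_smul hφ.continuousOn) hδl hxl hxr hδr
  rw [hφf le_rfl hδl (by linarith [hx.2]) (f x), hφf hδl (by linarith) hx.2.le l,
    hφf hx.1.le (by linarith) hδr r, hφf (by linarith [hx.1]) hδr le_rfl (f x), hIr, hIl] at hsplit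
  set P₁ := ∫ t in -Real.pi..(x - δ), φ t • (f t - f x)
  set P₂ := ∫ t in (x - δ)..x, φ t • (f t - l)
  set P₃ := ∫ t in x..x + δ, φ t • (f t - r)
  set P₄ := ∫ t in (x + δ)..Real.pi, φ t • (f t - f x)
  -- The kernel has mass `I` on each side of `x` and hence `π - 2I` on the outer pieces, where `f x`
  -- was subtracted. Regrouping leaves the defect `I - π/2`, which is at most `B` in absolute value.
  -- The factor `5` below is `1 + 2` from the outer pieces and `1 + 1` from these two terms.
  have hP : (∫ t in -Real.pi..Real.pi, φ t • f t) - (Real.pi / 2) • (r + l) =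
      P₁ + P₂ + P₃ + P₄ + (I - Real.pi / 2) • (r - f x) + (I - Real.pi / 2) • (l - f x) := by
    have e4 : ∫ t in (x + δ)..Real.pi, φ t =
        Real.pi - 2 * I - ∫ t in -Real.pi..(x - δ), φ t := by linarith
    rw [hsplit, e4]
    module
  have hIr' : ‖(I - Real.pi / 2) • (r - f x)‖ ≤ B * (w Real.pi - w (-Real.pi)) := by
    rw [norm_smul]
    exact mul_le_mul hIπ hr (norm_nonneg _) hB0
  have hIl' : ‖(I - Real.pi / 2) • (l - f x)‖ ≤ B * (w Real.pi - w (-Real.pi)) := by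
    rw [norm_smul]
    exact mul_le_mul hIπ hl (norm_nonneg _) hB0
  have hfin : ‖(∫ t in -Real.pi..Real.pi, φ t • f t) - (Real.pi / 2) • (r + l)‖ ≤
      5 * (B * (w Real.pi - w (-Real.pi))) + 30 * (w (x + δ) - Function.rightLim w x) +
        60 * (Function.leftLim w x - w (x - δ)) := by
    rw [hP]
    have n1 := norm_add_le (P₁ + P₂ + P₃ + P₄ + (I - Real.pi / 2) • (r - f x))
      ((I - Real.pi / 2) • (l - f x))
    have n2 := norm_add_le (P₁ + P₂ + P₃ + P₄) ((I - Real.pi / 2) • (r - f x))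
    have n3 := norm_add₄_le (a := P₁) (b := P₂) (c := P₃) (d := P₄)
    linarith
  have e5 : (1 / Real.pi) • (∫ t in -Real.pi..Real.pi, φ t • f t) - (1 / 2 : ℝ) • (r + l) =
      (1 / Real.pi) • ((∫ t in -Real.pi..Real.pi, φ t • f t) - (Real.pi / 2) • (r + l)) := by
    rw [smul_sub, smul_smul]
    congr 2
    field_simp
  rw [e5, norm_smul, Real.norm_eq_abs, abs_of_pos (by positivity)]
  have h1 : 1 / Real.pi ≤ 1 := by
    rw [div_le_one hpi]; linarith [Real.pi_gt_three]
  exact (mul_le_of_le_one_left (norm_nonneg _) h1).trans hfin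

end FourierSeries

/-! ### Metric selections, the metric integral and the final estimate. -/

section Main

variable {E : Type*} [NormedAddCommGroup E]

theorem intervalIntegrable_of_tendsto_chainFun {a b R : ℝ} (hab : a ≤ b)
    {χ : ℕ → IntervalPartition a b} {y : ∀ j, Fin ((χ j).n + 1) → E} {s : ℝ → E}
    (hR : ∀ t ∈ Icc a b, ‖s t‖ ≤ R)
    (hs : ∀ t ∈ Icc a b, Tendsto (fun j => chainFun (χ j) (y j) t) atTop (𝓝 (s t))) :
    IntervalIntegrable s MeasureTheory.volume a b := by
  rw [intervalIntegrable_iff_integrableOn_Icc_of_le hab]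
  refine MeasureTheory.Integrable.of_bound (aestronglyMeasurable_of_tendsto_ae atTop
    (fun j => (stronglyMeasurable_chainFun (χ j) (y j)).aestronglyMeasurable)
    (MeasureTheory.ae_restrict_of_forall_mem measurableSet_Icc hs)) R
    (MeasureTheory.ae_restrict_of_forall_mem measurableSet_Icc hR)

variable [NormedSpace ℝ E]

/-- The estimate for a single metric selection. -/
theorem norm_fourier_selection_sub_le [CompleteSpace E] {F : ℝ → NonemptyCompacts E}
    (hF : IsBVCompactGraph (-Real.pi) Real.pi F) {s : ℝ → E}
    (hs : IsMetricSelection (-Real.pi) Real.pi F s) {x δ : ℝ} {n : ℕ}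
    (hx : x ∈ Ioo (-Real.pi) Real.pi) (hδ : 0 < δ) (hδl : -Real.pi ≤ x - 2 * δ)
    (hδr : x + δ ≤ Real.pi) (hn : 1 ≤ n) :
    ‖(1 / Real.pi) • (∫ t in -Real.pi..Real.pi, dirichletKernel n (x - t) • s t) -
        (1 / 2 : ℝ) • (Function.rightLim s x + Function.leftLim s x)‖ ≤
      180 * ((variationFun F (-Real.pi) Real.pi / n) * (1 + 6 * Real.cot (δ / 2)) +
        omega F x δ) := by
  have hpi := Real.pi_pos
  have hab : -Real.pi ≤ Real.pi := by linarith
  obtain ⟨hsF, χ, y, hmesh, hy, hlim⟩ := hs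
  obtain ⟨R, hR⟩ := exists_norm_le_of_mem hF
  have hBV := hF.boundedVariation
  have hmono := monotone_extVariation hab hBV
  have hq_r := sub_rightLim_le_rightQuasiModulus hx hδ hδr hBV
  have hq_l := leftLim_sub_le_leftQuasiModulus (δ := 2 * δ) hx (by linarith) hδl hBV
  have hVle := extVariation_le hab hBV
  have hVnn := extVariation_nonneg F (-Real.pi) Real.pi
  have hctl := fun u hu v hv huv =>
    norm_limit_chainFun_sub_le hBV hmesh hy hlim (u := u) (v := v) hu hv huv
  set V := extVariation F (-Real.pi) Real.pi with hV
  set w : ℝ → ℝ := fun t => V t + Function.leftLim V t with hw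
  have hwm : Monotone w := hmono.add hmono.leftLim
  have h := norm_fourier_sub_le (f := s) (w := w) hwm hctl
    (intervalIntegrable_of_tendsto_chainFun hab (fun t ht => hR t ht _ (hsF t ht)) hlim)
    hx hδ (by linarith) hδr hn
  have hW : w Real.pi - w (-Real.pi) ≤ 2 * variationFun F (-Real.pi) Real.pi := by
    have h1 := hmono.leftLim_le (le_refl Real.pi)
    have h2 := hmono.le_leftLim (show -Real.pi - 1 < -Real.pi by linarith)
    simp only [hw]
    linarith [hVle Real.pi, hVnn (-Real.pi), hVnn (-Real.pi - 1)]
  have hright : 2 * Function.rightLim V x ≤ Function.rightLim w x := by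
    refine ge_of_tendsto (hwm.tendsto_rightLim x) (eventually_nhdsWithin_of_forall fun t ht => ?_)
    have h1 := hmono.rightLim_le (show x < t from ht)
    have h2 := hmono.rightLim_le_leftLim (show x < t from ht)
    simp only [hw]
    linarith
  have hleft : Function.leftLim w x ≤ 2 * Function.leftLim V x := by
    refine le_of_tendsto (hwm.tendsto_leftLim x) (eventually_nhdsWithin_of_forall fun t ht => ?_)
    have h1 := hmono.le_leftLim (show t < x from ht)
    have h2 := hmono.leftLim_le (le_refl t)
    simp only [hw]
    linarith
  have hwr : w (x + δ) ≤ 2 * V (x + δ) := by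
    have := hmono.leftLim_le (le_refl (x + δ))
    simp only [hw]
    linarith
  -- `w (x - δ)` involves the left limit of `V` at `x - δ`, which only a value of `V` further left
  -- bounds from below; this accounts for the step `2 * δ` in `omega`.
  have hwl : 2 * V (x - 2 * δ) ≤ w (x - δ) := by
    have h1 := hmono (show x - 2 * δ ≤ x - δ by linarith)
    have h2 := hmono.le_leftLim (show x - 2 * δ < x - δ by linarith)
    simp only [hw]
    linarith
  have hB0 : 0 ≤ 1 / (n : ℝ) * (1 + 6 * Real.cot (δ / 2)) := mul_nonneg (by positivity)
    (by linarith [cot_nonneg (p := δ / 2) (by linarith) (by linarith [hx.1])])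
  have hVF : 0 ≤ variationFun F (-Real.pi) Real.pi := ENNReal.toReal_nonneg
  have hBV2 := mul_le_mul_of_nonneg_left hW hB0
  have hBV0 := mul_nonneg hB0 hVF
  have e : variationFun F (-Real.pi) Real.pi / n * (1 + 6 * Real.cot (δ / 2)) =
      1 / (n : ℝ) * (1 + 6 * Real.cot (δ / 2)) * variationFun F (-Real.pi) Real.pi := by ring
  have hω_l : leftQuasiModulus (-Real.pi) Real.pi (variationFun F (-Real.pi)) x (2 * δ) ≤
    omega F x δ := le_max_left _ _
  have hω_r : rightQuasiModulus (-Real.pi) Real.pi (variationFun F (-Real.pi)) x δ ≤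
    omega F x δ := le_max_right _ _
  rw [e]
  -- The coefficient of `omega` is `30 * 2 + 60 * 2 = 180`, each `2` coming from `w` against `V`;
  -- the variation term needs only `5 * 2 = 10`.
  linarith

/-- The chains defining `s`, with their last entries dropped, give Riemann sums that converge to the
integral. -/
theorem IsMetricSelection.integral_mem_weightedMetricIntegral [CompleteSpace E] {a b : ℝ}
    (hab : a ≤ b) {F : ℝ → NonemptyCompacts E} (hF : IsBVCompactGraph a b F) {s : ℝ → E}
    (hs : IsMetricSelection a b F s) {k : ℝ → ℝ} (hk : Continuous k) :
    ∫ t in a..b, k t • s t ∈ weightedMetricIntegral a b k F := by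
  obtain ⟨-, χ, y, hmesh, hy, hlim⟩ := hs
  obtain ⟨R, hR⟩ := exists_norm_le_of_mem hF
  exact ⟨χ, _, hmesh, fun j => ⟨fun i => y j i.castSucc, (hy j).castSucc, rfl⟩,
    tendsto_weightedSum_integral hab hk hmesh
      (fun j i => hR _ ((χ j).pt_mem i) _ ((hy j).1 i)) hlim⟩

/-- Conversely, the chains behind a convergent sequence of Riemann sums are extended to the last
partition point, and Helly's principle yields `s`. Along the subsequence the sums tend both to `z`
and to the integral. -/
theorem exists_isMetricSelection_integral_eq [FiniteDimensional ℝ E] {a b : ℝ} (hab : a < b)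
    {F : ℝ → NonemptyCompacts E} (hF : IsBVCompactGraph a b F) {k : ℝ → ℝ} (hk : Continuous k)
    {z : E} (hz : z ∈ weightedMetricIntegral a b k F) :
    ∃ s, IsMetricSelection a b F s ∧ ∫ t in a..b, k t • s t = z := by
  have := FiniteDimensional.complete ℝ E
  obtain ⟨χ, v, hmesh, hv, hvz⟩ := hz
  choose y hy hvy using hv
  have hn : ∀ j, (χ j).n ≠ 0 := fun j h => by
    have h1 : (0 : Fin ((χ j).n + 1)) = Fin.last (χ j).n := by ext; simp [h]
    have h2 := (χ j).last
    rw [← h1, (χ j).first] at h2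
    exact hab.ne h2
  choose y' hy' hyy' using fun j =>
    exists_isMetricChain_extend (A := fun i => F ((χ j).pt i)) (hn j) (hy j)
  obtain ⟨φ, hφ, s, hsF, hs⟩ := exists_subseq_tendsto_chainFun hF hmesh hy'
  obtain ⟨R, hR⟩ := exists_norm_le_of_mem hF
  have hmφ := hmesh.comp hφ.tendsto_atTop
  refine ⟨s, ⟨hsF, fun j => χ (φ j), fun j => y' (φ j), hmφ, fun j => hy' _, hs⟩, ?_⟩
  refine tendsto_nhds_unique (tendsto_weightedSum_integral hab.le hk (χ := fun j => χ (φ j))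
    (y := fun j => y' (φ j)) hmφ (fun j i => hR _ ((χ (φ j)).pt_mem i) _ ((hy' (φ j)).1 i)) hs) ?_
  simpa only [hyy', ← hvy, Function.comp_def] using hvz.comp hφ.tendsto_atTop

theorem exists_isMetricSelection [FiniteDimensional ℝ E] {a b : ℝ} (hab : a < b)
    {F : ℝ → NonemptyCompacts E} (hF : IsBVCompactGraph a b F) :
    ∃ s, IsMetricSelection a b F s := by
  choose y hy using fun N => exists_isMetricChain
    fun i => F ((IntervalPartition.uniform hab N).pt i)
  have hmesh := IntervalPartition.tendsto_mesh_uniform hab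
  obtain ⟨φ, hφ, s, hsF, hs⟩ := exists_subseq_tendsto_chainFun hF hmesh hy
  exact ⟨s, hsF, _, fun j => y (φ j), hmesh.comp hφ.tendsto_atTop, fun j => hy _, hs⟩

end Main

end MetricFourier

theorem mainTheorem3 {E : Type*} [NormedAddCommGroup E] [NormedSpace ℝ E]
    [FiniteDimensional ℝ E] :
    ∃ K : ℝ, 0 < K ∧
      ∀ x ∈ Set.Ioo (-Real.pi) Real.pi, ∃ δ₀ : ℝ, 0 < δ₀ ∧
        ∀ F : ℝ → TopologicalSpace.NonemptyCompacts E,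
          MetricFourier.IsBVCompactGraph (-Real.pi) Real.pi F →
          ∀ δ ∈ Set.Ioc 0 δ₀, ∀ n : ℕ, 1 ≤ n →
            (MetricFourier.fourierSum n F x).Nonempty ∧
            (MetricFourier.limitSet F x).Nonempty ∧
            Metric.hausdorffEDist (MetricFourier.fourierSum n F x) (MetricFourier.limitSet F x) ≤
              ENNReal.ofReal
                (K * ((MetricFourier.variationFun F (-Real.pi) Real.pi / n) *
                    (1 + 6 * Real.cot (δ / 2)) + MetricFourier.omega F x δ)) := by
  have := FiniteDimensional.complete ℝ E
  have hpi := Real.pi_pos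
  have hab : -Real.pi < Real.pi := by linarith
  -- Half the distance from `x` to the nearer endpoint keeps both `x - 2 * δ` and `x + δ` in `[-π,
  -- π]`.
  refine ⟨180, by norm_num, fun x hx => ⟨min (x + Real.pi) (Real.pi - x) / 2,
    half_pos (lt_min (by linarith [hx.1]) (by linarith [hx.2])), fun F hF δ hδ n hn => ?_⟩⟩
  have hδl : -Real.pi ≤ x - 2 * δ := by
    linarith [hδ.2, min_le_left (x + Real.pi) (Real.pi - x)]
  have hδr : x + δ ≤ Real.pi := by
    linarith [hδ.1, hδ.2, min_le_right (x + Real.pi) (Real.pi - x)]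
  have hk : Continuous fun t => MetricFourier.dirichletKernel n (x - t) :=
    (MetricFourier.continuous_dirichletKernel n).comp (by fun_prop)
  have hest : ∀ s, MetricFourier.IsMetricSelection (-Real.pi) Real.pi F s → _ := fun s hs =>
    MetricFourier.norm_fourier_selection_sub_le hF hs hx hδ.1 hδl hδr hn
  have hmem : ∀ s, MetricFourier.IsMetricSelection (-Real.pi) Real.pi F s →
      (1 / Real.pi) • (∫ t in -Real.pi..Real.pi, MetricFourier.dirichletKernel n (x - t) • s t) ∈
        MetricFourier.fourierSum n F x := fun s hs =>
    ⟨_, hs.integral_mem_weightedMetricIntegral hab.le hF hk, rfl⟩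
  obtain ⟨s₀, hs₀⟩ := MetricFourier.exists_isMetricSelection hab hF
  refine ⟨⟨_, hmem s₀ hs₀⟩, ⟨_, s₀, hs₀, rfl⟩,
    Metric.hausdorffEDist_le_of_mem_edist ?_ ?_⟩
  -- In both directions a point is matched with the point of the other set given by the same
  -- selection `s`.
  · rintro _ ⟨z, hz, rfl⟩
    obtain ⟨s, hs, rfl⟩ := MetricFourier.exists_isMetricSelection_integral_eq hab hF hk hz
    refine ⟨_, ⟨s, hs, rfl⟩, ?_⟩
    rw [edist_dist, dist_eq_norm]
    exact ENNReal.ofReal_le_ofReal (hest s hs)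
  · rintro _ ⟨s, hs, rfl⟩
    refine ⟨_, hmem s hs, ?_⟩
    rw [edist_comm, edist_dist, dist_eq_norm]
    exact ENNReal.ofReal_le_ofReal (hest s hs)
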